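/- Let $M$ be a compact connected Riemannian manifold of finite dimension $d\ge 1$ with Riemannian distance $\mathrm{dist}$, balls $B_r(x)$, and a normalised smooth volume $\mathrm{Leb}$. Let $f:M\to M$ be a measurable map which is continuous on a set $Y$ of full $\mathrm{Leb}$-measure, and suppose that some $x_0\in M$ has an orbit $\{f^n x_0:n\ge 0\}$ which is dense in $M$ and contained in $Y$. Assume that $f$ is randomly perturbed in one of the following two ways. (a) *Random maps.* $X$ is a compact metric space, $\theta$ a Borel probability measure on $X$ and $F:M\times X\to M$, $F(x,\omega)=f_\omega(x)=f^x(\omega)$, a measurable map. For some $\omega_0\in X$ and $\varepsilon_0>0$ we have $f_{\omega_0}=f$ and $\mathrm{supp}\,\theta\supset\{\omega: d(\omega,\omega_0)<\varepsilon_0\}$, and there are constants $\rho_0>0$ and $\overline q>\underline q>0$ such that for $\mathrm{Leb}$-a.e. $x$: $\mathrm{supp}\big((f^x)_*\theta\big)\supset B_{\rho_0}(f x)$ (when $f^x$ is continuous this says $f^x(\mathrm{supp}\,\theta)\supset B_{\rho_0}(fx)$), and $(f^x)_*\theta=q_x\,\mathrm{Leb}$ with $\underline q\le q_x\le\overline q$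 $\mathrm{Leb}$-a.e. on $\mathrm{supp}\big((f^x)_*\theta\big)$. Let $\mu$ be a stationary probability measure, i.e. $\iint\varphi(f_\omega(x))\,d\theta(\omega)\,d\mu(x)=\int\varphi\,d\mu$ for all $\mu$-integrable $\varphi$, and assume that $(f^x)_*\theta\ll\mathrm{Leb}$ also for $\mu$-a.e. $x$ (this is automatic if it holds for every $x$). (b) *Markov chain.* $p_x=q_x\,\mathrm{Leb}$, $x\in M$, are probability measures whose densities $q_x$ are positive, Hölder continuous (for some exponent $\alpha>0$) and vary continuously with $x\in M$ in the $C^0$ topology, and there are $\rho_0>0$, $\overline q>\underline q>0$ with $\mathrm{supp}(q_x)\supset B_{\rho_0}(fx)$ and $\underline q\le q_x\le\overline q$ for all $x\in Y$. Let $\mu$ be a stationary probability measure for $(p_x)$, i.e. $\iint\varphi\,dp_x\,d\mu(x)=\int\varphi\,d\mu$ for all $\mu$-integrable $\varphi$. The chain is represented by random maps: $(X,\theta)$ is any probability space and $F:M\times X\to M$, $F(x,\omega)=f_\omega(x)=f^x(\omega)$, any measurable map with $(f^x)_*\theta=p_x$ for all $x\in M$. Put $\Omega=X^{\mathbb N}$,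 $\mathbb P=\mu\times\theta^{\mathbb N}$ and $S:M\times\Omega\to M\times\Omega$, $S(x,\underline\omega)=(f_{\omega_1}(x),\sigma\underline\omega)$ with $\sigma$ the one-sided shift. For $A\subset M\times\Omega$ let $r_A(z)=\min\{j\ge 1: S^j z\in A\}\in\{1,2,\dots\}\cup\{\infty\}$. Then for every $\zeta\in M$ and every sequence $\delta_n>0$ with $\delta_n\to 0$, the sets $V_n=B_{\delta_n}(\zeta)\times\Omega$ satisfy $\mathbb P(V_n)>0$, $\mathbb P(V_n)\to 0$, and the system has exponential hitting and return time statistics for $(V_n)$: for all $t\ge 0$, $$\mathbb P\Big(r_{V_n}\le \frac{t}{\mathbb P(V_n)}\Big)\to 1-e^{-t},\qquad \mathbb P\Big(r_{V_n}\le \frac{t}{\mathbb P(V_n)}\,\Big|\,V_n\Big)\to 1-e^{-t}\qquad(n\to\infty).$$ In case (b) the same holds on path space, i.e. for $M^{\mathbb N}$ (times $0,1,2,\dots$) with the law of the Markov chain with initial law $\mu$ and transition probabilities $(p_x)$, the shift map, and $V_n=\{z: z_0\in B_{\delta_n}(\zeta)\}$. -/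

import Mathlib

open MeasureTheory ProbabilityTheory Set Filter Topology Manifold Bundle
open scoped ENNReal NNReal ContDiff

universe u v w

noncomputable section

/-- `Leb` is given by a smooth nowhere vanishing volume form (density) on the `d`-dimensional
manifold `M`: in every chart of the atlas it has a smooth positive density with respect to the
Lebesgue measure of `ℝ^d`. Together with `IsProbabilityMeasure Leb` this is a normalised volume
form; the normalised Riemannian volume of any smooth Riemannian metric is of this kind. -/
def IsSmoothVolume (d : ℕ) {M : Type*} [TopologicalSpace M] [MeasurableSpace M]
    [ChartedSpace (EuclideanSpace ℝ (Fin d)) M] (Leb : Measure M) : Prop :=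
  ∀ e ∈ atlas (EuclideanSpace ℝ (Fin d)) M,
    ∃ ρ : EuclideanSpace ℝ (Fin d) → ℝ,
      ContDiffOn ℝ ∞ ρ e.target ∧ (∀ y ∈ e.target, 0 < ρ y) ∧
      ∀ A : Set M, MeasurableSet A → A ⊆ e.source →
        Leb A = ∫⁻ y in e '' A, ENNReal.ofReal (ρ y)

section Statistics

variable {𝒳 : Type*} [MeasurableSpace 𝒳]

/-- The first hitting time of `A` (its restriction to `A` is the first return time):
the least `j ≥ 1` with `T^j z ∈ A`, and `∞` if there is none. -/
def hitTime (T : 𝒳 → 𝒳) (A : Set 𝒳) (z : 𝒳) : ℕ∞ :=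
  ⨅ (j : ℕ) (_ : 1 ≤ j ∧ T^[j] z ∈ A), (j : ℕ∞)

/-- The rare event `{r_A ≤ t / ℙ(A)}`. -/
def hitEvent (P : Measure 𝒳) (T : 𝒳 → 𝒳) (A : Set 𝒳) (t : ℝ) : Set 𝒳 :=
  {z | (hitTime T A z : ℝ≥0∞) ≤ ENNReal.ofReal t / P A}

/-- The sets `V n` are measurable, of positive measure, and their measures tend to `0`. -/
structure IsRareSequence (P : Measure 𝒳) (V : ℕ → Set 𝒳) : Prop where
  measurable : ∀ n, MeasurableSet (V n)
  pos : ∀ n, 0 < P (V n)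
  tendsto_zero : Tendsto (fun n => P (V n)) atTop (𝓝 0)

/-- The system `(𝒳, P, T)` has Hitting Time Statistics `G` for `(V n)`. -/
def HasHTS (P : Measure 𝒳) (T : 𝒳 → 𝒳) (V : ℕ → Set 𝒳) (G : ℝ → ℝ) : Prop :=
  IsRareSequence P V ∧
  ∀ t : ℝ, 0 ≤ t → Tendsto (fun n => P.real (hitEvent P T (V n) t)) atTop (𝓝 (G t))

/-- The system `(𝒳, P, T)` has Return Time Statistics `G` for `(V n)`; here `P[|V n]` is the
conditional probability given `V n`. -/
def HasRTS (P : Measure 𝒳) (T : 𝒳 → 𝒳) (V : ℕ → Set 𝒳) (G : ℝ → ℝ) : Prop :=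
  IsRareSequence P V ∧
  ∀ t : ℝ, 0 ≤ t → Tendsto (fun n => (P[|V n]).real (hitEvent P T (V n) t)) atTop (𝓝 (G t))

/-- Exponential hitting and return time statistics: `G(t) = G̃(t) = 1 - e^{-t}`. -/
def HasExponentialHTSRTS (P : Measure 𝒳) (T : 𝒳 → 𝒳) (V : ℕ → Set 𝒳) : Prop :=
  HasHTS P T V (fun t => 1 - Real.exp (-t)) ∧ HasRTS P T V (fun t => 1 - Real.exp (-t))

end Statistics

section RandomMaps

variable {M : Type*} [MeasurableSpace M]

/-- The probability measure `μ` is stationary for the transition probabilities `p`: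
`∫∫ φ(y) dp_x(y) dμ(x) = ∫ φ dμ` for all `μ`-integrable `φ`. -/
def IsStationaryMeasure (p : M → Measure M) (μ : Measure M) : Prop :=
  ∀ φ : M → ℝ, Integrable φ μ → ∫ x, ∫ y, φ y ∂(p x) ∂μ = ∫ x, φ x ∂μ

variable {X : Type*} [MeasurableSpace X]

/-- The transition probabilities `p_x = (f^x)_* θ` of the random maps `f_ω = F(·, ω)`, where
`f^x(ω) = F(x, ω)` and `ω` has law `θ`. -/
def transition (F : M → X → M) (θ : Measure X) (x : M) : Measure M :=
  θ.map (F x)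

/-- The skew product `S(x, ω) = (f_{ω₁}(x), σ ω)` on `M × X^ℕ`, with `σ` the shift. -/
def skewProduct (F : M → X → M) (z : M × (ℕ → X)) : M × (ℕ → X) :=
  (F z.1 (z.2 0), fun n => z.2 (n + 1))

/-- The measure `μ × θ^ℕ` on `M × X^ℕ`. -/
def annealed (μ : Measure M) (θ : Measure X) : Measure (M × (ℕ → X)) :=
  μ.prod (Measure.infinitePi fun _ : ℕ => θ)

end RandomMaps

/-- `(f_ω, θ)` is a uniformly continuous random perturbation of `f`:
for some `ω₀` and `ε₀ > 0` one has `supp θ ⊇ V_{ε₀}(ω₀)` and `f_{ω₀} = f`, and there are constants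
`ρ₀ > 0` and `qhi > qlo > 0` such that for `Leb`-a.e. `x` the law `(f^x)_* θ` of the perturbed image
of `x` charges every part of the ball `B_{ρ₀}(f x)`, i.e. its support contains that ball, and
`(f^x)_* θ = q_x Leb` with `qlo ≤ q_x ≤ qhi` `Leb`-a.e. on the support of `(f^x)_* θ`.
If `f^x` is continuous on the compact parameter space, then the support of `(f^x)_* θ`
is `f^x (supp θ)`. -/
def IsUniformRandomPerturbation {M : Type*} [MetricSpace M] [MeasurableSpace M]
    {X : Type*} [MetricSpace X] [MeasurableSpace X]
    (Leb : Measure M) (f : M → M) (F : M → X → M) (θ : Measure X) : Prop :=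
  (∃ (ω₀ : X) (ε₀ : ℝ), 0 < ε₀ ∧ Metric.ball ω₀ ε₀ ⊆ θ.support ∧ ∀ x, F x ω₀ = f x) ∧
  (∃ ρ₀ : ℝ, 0 < ρ₀ ∧
    ∀ᵐ x ∂Leb, Metric.ball (f x) ρ₀ ⊆ (transition F θ x).support) ∧
  ∃ qlo qhi : ℝ≥0, 0 < qlo ∧ qlo < qhi ∧
    ∀ᵐ x ∂Leb, ∃ q : M → ℝ≥0, Measurable q ∧
      transition F θ x = Leb.withDensity (fun y => (q y : ℝ≥0∞)) ∧
      ∀ᵐ y ∂Leb, y ∈ (transition F θ x).support → qlo ≤ q y ∧ q y ≤ qhi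

section MarkovChains

variable {M : Type*} [MeasurableSpace M]

/-- The measure `p_x = q_x Leb`. -/
def densityKernel [TopologicalSpace M] (Leb : Measure M) (q : M → C(M, ℝ)) (x : M) : Measure M :=
  Leb.withDensity (fun y => ENNReal.ofReal (q x y))

/-- The transition probabilities `p_x = q_x Leb` have positive Hölder continuous
probability densities `q_x`, which depend continuously on `x` in the `C⁰` topology, and there are
`ρ₀ > 0` and `qhi > qlo > 0` with `supp q_x ⊇ B_{ρ₀}(f x)` and `qlo ≤ q_x ≤ qhi` for `x ∈ Y`. -/
structure IsRegularMarkovPerturbation [MetricSpace M]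
    (Leb : Measure M) (f : M → M) (Y : Set M) (q : M → C(M, ℝ)) : Prop where
  pos : ∀ x y, 0 < q x y
  isProbability : ∀ x, IsProbabilityMeasure (densityKernel Leb q x)
  holder : ∀ x, ∃ C α : ℝ≥0, 0 < α ∧ HolderWith C α (q x)
  continuous : Continuous q
  cover : ∃ ρ₀ : ℝ, 0 < ρ₀ ∧ ∀ x ∈ Y, Metric.ball (f x) ρ₀ ⊆ tsupport (q x)
  bounds : ∃ qlo qhi : ℝ, 0 < qlo ∧ qlo < qhi ∧ ∀ x ∈ Y, ∀ y, qlo ≤ q x y ∧ q x y ≤ qhi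

/-- `P` is the law on path space `M^ℕ` of the Markov chain with initial law `μ` and transition
probabilities `p`. -/
structure IsMarkovChainLaw (p : M → Measure M) (μ : Measure M) (P : Measure (ℕ → M)) : Prop where
  init : P.map (fun z => z 0) = μ
  step : ∀ (n : ℕ) (A : Set (Fin (n + 1) → M)) (B : Set M), MeasurableSet A → MeasurableSet B →
    P {z | (fun i : Fin (n + 1) => z i) ∈ A ∧ z (n + 1) ∈ B} =
      ∫⁻ z in {z | (fun i : Fin (n + 1) => z i) ∈ A}, p (z n) B ∂P

/-- The one-sided shift on path space. -/
def pathShift (z : ℕ → M) : ℕ → M := fun n => z (n + 1)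

end MarkovChains

end

/-!
Both schemes give a Markov kernel `κ` on `M` whose transition probabilities `κ x` have densities
that are bounded above, and bounded away from zero on a ball of fixed radius about `f x`. Skew
product and path space differ only by the factor map `(x, ω) ↦ (random orbit of x)`, so everything
happens for the Markov chain.

Mixing. The neighbourhoods of the points of the dense orbit `z n = f^n x₀` are linked by `κ`
whenever `z (i + 1)` is close to `z j`. Following the orbit and jumping between its nearby points
gives loops at every index, and since `M` is connected their lengths have greatest common
divisor `1`; by compactness some power of `κ` then dominates a fixed measure from almost every
starting point. This Doeblin minorization makes the chain forget its starting point uniformly.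

Exponential law. Let `B` be a small ball. Discarding the first `s` steps after a visit to `B` costs
`O(s Leb B)` because the densities are bounded, and by then the chain is almost stationary. Hence
the probability of avoiding `B` during `m` steps is almost the same when starting in `B` as when
starting from `μ`. Stationarity turns the former into the decrement in `m` of the latter, which is
therefore asymptotically geometric with ratio `1 - μ B`, and letting `m ≈ t / μ B` gives `e^{-t}`.
-/

noncomputable section

section Statistics

variable {𝒳 : Type*} [MeasurableSpace 𝒳]

/-- The set of points whose orbit under `T` does not visit `A` at the times `1, …, m`. Its
complement for `m = ⌊t / P A⌋` is the rare event `{r_A ≤ t / P A}`. -/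
def survivalSet {𝒳 : Type*} (T : 𝒳 → 𝒳) (A : Set 𝒳) (m : ℕ) : Set 𝒳 :=
  {z | ∀ j, 1 ≤ j → j ≤ m → T^[j] z ∉ A}

theorem survivalSet_zero {𝒳 : Type*} (T : 𝒳 → 𝒳) (A : Set 𝒳) : survivalSet T A 0 = univ :=
  eq_univ_of_forall fun _ _ h₁ h₀ => absurd (h₁.trans h₀) (by simp)

theorem survivalSet_succ {𝒳 : Type*} (T : 𝒳 → 𝒳) (A : Set 𝒳) (m : ℕ) :
    survivalSet T A (m + 1) = survivalSet T A m ∩ T^[m + 1] ⁻¹' Aᶜ := by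
  ext z
  simp only [survivalSet, mem_ofPred_eq, mem_inter_iff, mem_preimage, mem_compl_iff]
  refine ⟨fun h => ⟨fun j h₁ hj => h j h₁ (hj.trans m.le_succ), h _ (by simp) le_rfl⟩, ?_⟩
  rintro ⟨h, hm⟩ j h₁ hj
  rcases hj.lt_or_eq with hj | rfl
  · exact h j h₁ (Nat.lt_succ_iff.1 hj)
  · exact hm

theorem measurableSet_survivalSet {T : 𝒳 → 𝒳} (hT : Measurable T) {A : Set 𝒳}
    (hA : MeasurableSet A) (m : ℕ) : MeasurableSet (survivalSet T A m) := by
  induction m with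
  | zero => simp [survivalSet_zero]
  | succ m ih =>
    rw [survivalSet_succ]
    exact ih.inter (hT.iterate _ hA.compl)

theorem hitTime_le_iff {𝒳 : Type*} {T : 𝒳 → 𝒳} {A : Set 𝒳} {z : 𝒳} {m : ℕ} :
    hitTime T A z ≤ m ↔ ∃ j, 1 ≤ j ∧ j ≤ m ∧ T^[j] z ∈ A := by
  rw [← Order.lt_add_one_iff_of_not_isMax (by simp), hitTime]
  simp only [iInf_lt_iff, exists_prop]
  refine exists_congr fun j => ?_
  rw [and_assoc, and_comm (a := j ≤ m)]
  norm_cast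
  rw [Nat.lt_succ_iff]

theorem toENNReal_le_ofReal_iff_le_floor {n : ℕ∞} {x : ℝ} (hx : 0 ≤ x) :
    (n : ℝ≥0∞) ≤ ENNReal.ofReal x ↔ n ≤ ⌊x⌋₊ := by
  cases n with
  | top => simp
  | coe n =>
    rw [ENat.toENNReal_coe, ← ENNReal.ofReal_natCast, ENNReal.ofReal_le_ofReal_iff hx,
      Nat.cast_le, Nat.le_floor_iff hx]

theorem hitEvent_eq_compl_survivalSet {P : Measure 𝒳} [IsFiniteMeasure P] (T : 𝒳 → 𝒳)
    {A : Set 𝒳} (hA : P A ≠ 0) {t : ℝ} (ht : 0 ≤ t) :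
    hitEvent P T A t = (survivalSet T A ⌊t / P.real A⌋₊)ᶜ := by
  have hp : 0 < P.real A := ENNReal.toReal_pos hA (measure_ne_top P A)
  have hx : ENNReal.ofReal t / P A = ENNReal.ofReal (t / P.real A) := by
    rw [ENNReal.ofReal_div_of_pos hp, ofReal_measureReal]
  ext z
  rw [hitEvent, hx, mem_ofPred_eq, toENNReal_le_ofReal_iff_le_floor (by positivity), hitTime_le_iff]
  simp [survivalSet]

theorem abs_sub_pow_le_of_recursion {a b : ℕ → ℝ} {p e : ℝ} (hp₀ : 0 ≤ p) (hp₁ : p ≤ 1)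
    (h₀ : a 0 = 1) (hrec : ∀ m, a (m + 1) = a m - p * b m) (hab : ∀ m, |b m - a m| ≤ e) (m : ℕ) :
    |a m - (1 - p) ^ m| ≤ e := by
  induction m with
  | zero => simpa [h₀] using (abs_nonneg _).trans (hab 0)
  | succ m ih =>
    calc |a (m + 1) - (1 - p) ^ (m + 1)|
        = |(1 - p) * (a m - (1 - p) ^ m) - p * (b m - a m)| := by rw [hrec]; ring_nf
      _ ≤ (1 - p) * |a m - (1 - p) ^ m| + p * |b m - a m| := by
        grw [abs_sub, abs_mul, abs_mul, abs_of_nonneg hp₀, abs_of_nonneg (sub_nonneg.2 hp₁)]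
      _ ≤ (1 - p) * e + p * e := by
        have := sub_nonneg.2 hp₁
        gcongr
        exact hab m
      _ = e := by ring

theorem tendsto_floor_div_mul {p : ℕ → ℝ} (hp : ∀ n, 0 < p n) (h₀ : Tendsto p atTop (𝓝 0))
    {t : ℝ} (ht : 0 ≤ t) : Tendsto (fun n => ⌊t / p n⌋₊ * p n) atTop (𝓝 t) := by
  have hinv : Tendsto (fun n => (p n)⁻¹) atTop atTop :=
    (tendsto_nhdsWithin_iff.2 ⟨h₀, Eventually.of_forall hp⟩).inv_tendsto_nhdsGT_zero
  simpa [Function.comp_def, div_eq_mul_inv] using (tendsto_nat_floor_mul_div_atTop ht).comp hinv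

theorem tendsto_log_one_sub_div {p : ℕ → ℝ} (hp : ∀ n, 0 < p n) (h₀ : Tendsto p atTop (𝓝 0)) :
    Tendsto (fun n => Real.log (1 - p n) / p n) atTop (𝓝 (-1)) := by
  have hderiv : HasDerivAt (fun x : ℝ => Real.log (1 - x)) (-1) 0 := by
    simpa using ((hasDerivAt_id (0 : ℝ)).const_sub 1).log (by simp)
  have hp' : Tendsto p atTop (𝓝[≠] 0) :=
    tendsto_nhdsWithin_iff.2 ⟨h₀, Eventually.of_forall fun n => (hp n).ne'⟩
  simpa [Function.comp_def, div_eq_inv_mul] using hderiv.tendsto_slope_zero.comp hp'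

theorem tendsto_one_sub_pow_floor {p : ℕ → ℝ} (hp : ∀ n, 0 < p n) (h₀ : Tendsto p atTop (𝓝 0))
    {t : ℝ} (ht : 0 ≤ t) :
    Tendsto (fun n => (1 - p n) ^ ⌊t / p n⌋₊) atTop (𝓝 (Real.exp (-t))) := by
  have h : Tendsto (fun n => Real.exp (⌊t / p n⌋₊ * p n * (Real.log (1 - p n) / p n))) atTop
      (𝓝 (Real.exp (t * -1))) :=
    (Real.continuous_exp.tendsto _).comp
      ((tendsto_floor_div_mul hp h₀ ht).mul (tendsto_log_one_sub_div hp h₀))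
  rw [mul_neg_one] at h
  refine h.congr' ?_
  filter_upwards [h₀.eventually (gt_mem_nhds one_pos)] with n hn
  rw [mul_assoc, mul_div_cancel₀ _ (hp n).ne', mul_comm, Real.exp_mul,
    Real.exp_log (sub_pos.2 hn), Real.rpow_natCast]

theorem tendsto_exp_neg_of_recursion {a b : ℕ → ℕ → ℝ} {p : ℕ → ℝ} (hp : ∀ n, 0 < p n)
    (hp₀ : Tendsto p atTop (𝓝 0)) (ha : ∀ n, a n 0 = 1)
    (hrec : ∀ n m, a n (m + 1) = a n m - p n * b n m)
    (hab : ∀ e > 0, ∀ᶠ n in atTop, ∀ m, |b n m - a n m| ≤ e) {t : ℝ} (ht : 0 ≤ t) :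
    Tendsto (fun n => a n ⌊t / p n⌋₊) atTop (𝓝 (Real.exp (-t))) ∧
      Tendsto (fun n => b n ⌊t / p n⌋₊) atTop (𝓝 (Real.exp (-t))) := by
  have ha_sub : Tendsto (fun n => a n ⌊t / p n⌋₊ - (1 - p n) ^ ⌊t / p n⌋₊) atTop (𝓝 0) := by
    refine Metric.tendsto_nhds.2 fun e he => ?_
    filter_upwards [hab (e / 2) (half_pos he), hp₀.eventually (ge_mem_nhds one_pos)] with n hn hpn
    simpa using (abs_sub_pow_le_of_recursion (hp n).le hpn (ha n) (hrec n) hn _).trans_lt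
      (half_lt_self he)
  have hb_sub : Tendsto (fun n => b n ⌊t / p n⌋₊ - a n ⌊t / p n⌋₊) atTop (𝓝 0) := by
    refine Metric.tendsto_nhds.2 fun e he => ?_
    filter_upwards [hab (e / 2) (half_pos he)] with n hn
    simpa using (hn _).trans_lt (half_lt_self he)
  have hlim : Tendsto (fun n => a n ⌊t / p n⌋₊) atTop (𝓝 (Real.exp (-t))) := by
    simpa using ha_sub.add (tendsto_one_sub_pow_floor hp hp₀ ht)
  exact ⟨hlim, by simpa using hb_sub.add hlim⟩

theorem hasExponentialHTSRTS_of_survivalSet {P : Measure 𝒳} [IsProbabilityMeasure P]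
    {T : 𝒳 → 𝒳} (hT : Measurable T) {V : ℕ → Set 𝒳} (hV : IsRareSequence P V)
    (hrec : ∀ n m, P (survivalSet T (V n) (m + 1)) = P (survivalSet T (V n) m \ V n))
    (hcond : ∀ e > 0, ∀ᶠ n in atTop, ∀ m,
      |(P[|V n]).real (survivalSet T (V n) m) - P.real (survivalSet T (V n) m)| ≤ e) :
    HasExponentialHTSRTS P T V := by
  have hS : ∀ n m, MeasurableSet (survivalSet T (V n) m) := fun n =>
    measurableSet_survivalSet hT (hV.measurable n)
  have hp : ∀ n, 0 < P.real (V n) := fun n =>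
    ENNReal.toReal_pos (hV.pos n).ne' (measure_ne_top P _)
  have hp₀ : Tendsto (fun n => P.real (V n)) atTop (𝓝 0) := by
    simpa [Measure.real, Function.comp_def] using
      (ENNReal.tendsto_toReal ENNReal.zero_ne_top).comp hV.tendsto_zero
  have hrec' : ∀ n m, P.real (survivalSet T (V n) (m + 1)) = P.real (survivalSet T (V n) m) -
      P.real (V n) * (P[|V n]).real (survivalSet T (V n) m) := fun n m => by
    have hinter : (P[|V n]).real (survivalSet T (V n) m) * P.real (V n) =
        P.real (survivalSet T (V n) m ∩ V n) := by
      rw [inter_comm, measureReal_def, measureReal_def, measureReal_def,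
        ← cond_mul_eq_inter (hV.measurable n), ENNReal.toReal_mul]
    rw [mul_comm, hinter, measureReal_def, hrec, ← measureReal_def, eq_sub_iff_add_eq',
      measureReal_inter_add_sdiff₀ (hV.measurable n).nullMeasurableSet]
  have hlim {t : ℝ} (ht : 0 ≤ t) := tendsto_exp_neg_of_recursion hp hp₀
    (fun n => by simp [survivalSet_zero]) hrec' hcond ht
  refine ⟨⟨hV, fun t ht => ((hlim ht).1.const_sub 1).congr fun n => ?_⟩,
    hV, fun t ht => ((hlim ht).2.const_sub 1).congr fun n => ?_⟩
  · rw [hitEvent_eq_compl_survivalSet T (hV.pos n).ne' ht, probReal_compl_eq_one_sub (hS _ _)]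
  · have := cond_isProbabilityMeasure (hV.pos n).ne'
    rw [hitEvent_eq_compl_survivalSet T (hV.pos n).ne' ht, probReal_compl_eq_one_sub (hS _ _)]

theorem preimage_hitEvent {𝒴 : Type*} [MeasurableSpace 𝒴] {P : Measure 𝒳} {Q : Measure 𝒴}
    {T : 𝒳 → 𝒳} {T' : 𝒴 → 𝒴} {Φ : 𝒳 → 𝒴} (hΦ : MeasurePreserving Φ P Q)
    (hsemi : Function.Semiconj Φ T T') {A : Set 𝒴} (hA : MeasurableSet A) (t : ℝ) :
    Φ ⁻¹' hitEvent Q T' A t = hitEvent P T (Φ ⁻¹' A) t := by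
  ext z
  simp only [hitEvent, hitTime, mem_preimage, mem_ofPred_eq, (hsemi.iterate_right _).eq,
    hΦ.measure_preimage hA.nullMeasurableSet]

theorem HasExponentialHTSRTS.of_semiconj {𝒴 : Type*} [MeasurableSpace 𝒴] {P : Measure 𝒳}
    {Q : Measure 𝒴} [IsFiniteMeasure Q] {T : 𝒳 → 𝒳} {T' : 𝒴 → 𝒴} {Φ : 𝒳 → 𝒴}
    {V : ℕ → Set 𝒴} (h : HasExponentialHTSRTS Q T' V) (hT' : Measurable T')
    (hΦ : MeasurePreserving Φ P Q) (hsemi : Function.Semiconj Φ T T') :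
    HasExponentialHTSRTS P T (fun n => Φ ⁻¹' V n) := by
  obtain ⟨⟨hV, hhit⟩, -, hret⟩ := h
  have hpre : ∀ {A : Set 𝒴}, MeasurableSet A → P (Φ ⁻¹' A) = Q A := fun hA =>
    hΦ.measure_preimage hA.nullMeasurableSet
  have hrare : IsRareSequence P (fun n => Φ ⁻¹' V n) := by
    refine ⟨fun n => hΦ.measurable (hV.measurable n), fun n => ?_, ?_⟩
    · simpa only [hpre (hV.measurable n)] using hV.pos n
    · simpa only [hpre (hV.measurable _)] using hV.tendsto_zero
  have hE : ∀ n {t : ℝ}, 0 ≤ t → MeasurableSet (hitEvent Q T' (V n) t) := fun n t ht => by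
    rw [hitEvent_eq_compl_survivalSet T' (hV.pos n).ne' ht]
    exact (measurableSet_survivalSet hT' (hV.measurable n) _).compl
  refine ⟨⟨hrare, fun t ht => (hhit t ht).congr fun n => ?_⟩,
    hrare, fun t ht => (hret t ht).congr fun n => ?_⟩
  · rw [← preimage_hitEvent hΦ hsemi (hV.measurable n), measureReal_def, measureReal_def,
      hpre (hE n ht)]
  · rw [← preimage_hitEvent hΦ hsemi (hV.measurable n), measureReal_def, measureReal_def,
      cond_apply (hV.measurable n), cond_apply (hΦ.measurable (hV.measurable n)),
      ← preimage_inter, hpre (hV.measurable n), hpre ((hV.measurable n).inter (hE n ht))]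

end Statistics

section Mixing

variable {M : Type*} [MeasurableSpace M] {κ : Kernel M M} {Leb μ : Measure M}

instance isMarkovKernel_pow [IsMarkovKernel κ] (n : ℕ) : IsMarkovKernel (κ ^ n) := by
  induction n with
  | zero => exact inferInstanceAs (IsMarkovKernel Kernel.id)
  | succ n ih => exact inferInstanceAs (IsMarkovKernel ((κ ^ n) ∘ₖ κ))

theorem kernel_one_apply (x : M) : (1 : Kernel M M) x = Measure.dirac x :=
  Kernel.id_apply x

theorem lintegral_pow_add (κ : Kernel M M) (m n : ℕ) {φ : M → ℝ≥0∞} (hφ : Measurable φ) (x : M) :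
    ∫⁻ y, φ y ∂(κ ^ (m + n)) x = ∫⁻ y, ∫⁻ w, φ w ∂(κ ^ m) y ∂(κ ^ n) x := by
  rw [Kernel.pow_add, Kernel.lintegral_comp _ _ _ hφ]

theorem lintegral_pow_succ (κ : Kernel M M) (n : ℕ) {φ : M → ℝ≥0∞} (hφ : Measurable φ) (x : M) :
    ∫⁻ y, φ y ∂(κ ^ (n + 1)) x = ∫⁻ y, ∫⁻ w, φ w ∂(κ ^ n) y ∂κ x := by
  simpa using lintegral_pow_add κ n 1 hφ x

theorem invariant_pow (hμ : κ.Invariant μ) (n : ℕ) : (κ ^ n).Invariant μ := by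
  induction n with
  | zero => exact Measure.bind_dirac
  | succ n ih => exact ih.comp hμ

theorem lintegral_invariant {φ : M → ℝ≥0∞} (hφ : Measurable φ) (hμ : κ.Invariant μ) :
    ∫⁻ x, ∫⁻ y, φ y ∂κ x ∂μ = ∫⁻ x, φ x ∂μ := by
  conv_rhs => rw [← hμ.def, Measure.lintegral_bind κ.aemeasurable hφ.aemeasurable]

theorem ae_ae_pow (hac : ∀ᵐ x ∂Leb, κ x ≪ Leb) {p : M → Prop} (hp : ∀ᵐ x ∂Leb, p x) (n : ℕ) :
    ∀ᵐ x ∂Leb, ∀ᵐ y ∂(κ ^ n) x, p y := by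
  obtain ⟨t, hpt, ht, ht₀⟩ := exists_measurable_superset_of_null (ae_iff.1 hp)
  suffices h : ∀ᵐ x ∂Leb, (κ ^ n) x t = 0 from h.mono fun x hx => measure_mono_null hpt hx
  induction n with
  | zero =>
    filter_upwards [measure_eq_zero_iff_ae_notMem.1 ht₀] with x hx
    simp [kernel_one_apply, ht, hx]
  | succ n ih =>
    filter_upwards [hac] with x hx
    rw [add_comm, Kernel.pow_add_apply_eq_lintegral _ _ _ _ ht, pow_one,
      lintegral_congr_ae (hx ih), lintegral_zero]

theorem lintegral_mem_Icc_of_le {ν P : Measure M} [IsProbabilityMeasure P] (hν : ν ≤ P)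
    {φ : M → ℝ≥0∞} {a D : ℝ≥0∞} (hφ : ∀ᵐ x ∂P, φ x ∈ Icc a (a + D)) :
    ∫⁻ x, φ x ∂P ∈ Icc (∫⁻ x, φ x ∂ν + a * (1 - ν univ))
      (∫⁻ x, φ x ∂ν + a * (1 - ν univ) + D * (1 - ν univ)) := by
  have : IsFiniteMeasure ν := isFiniteMeasure_of_le P hν
  have hsub : (P - ν) univ = 1 - ν univ := by
    rw [Measure.sub_apply .univ hν, measure_univ]
  have hφ' : ∀ᵐ x ∂(P - ν), φ x ∈ Icc a (a + D) := Measure.sub_le.absolutelyContinuous hφ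
  have hP : ∫⁻ x, φ x ∂P = ∫⁻ x, φ x ∂ν + ∫⁻ x, φ x ∂(P - ν) := by
    conv_lhs => rw [← Measure.sub_add_cancel_of_le hν, lintegral_add_measure, add_comm]
  rw [hP, add_assoc, ← add_mul]
  constructor
  · gcongr
    calc a * (1 - ν univ) = ∫⁻ _, a ∂(P - ν) := by rw [lintegral_const, hsub]
      _ ≤ ∫⁻ x, φ x ∂(P - ν) := lintegral_mono_ae (hφ'.mono fun _ h => h.1)
  · gcongr
    calc ∫⁻ x, φ x ∂(P - ν) ≤ ∫⁻ _, a + D ∂(P - ν) := lintegral_mono_ae (hφ'.mono fun _ h => h.2)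
      _ = (a + D) * (1 - ν univ) := by rw [lintegral_const, hsub]

/-- After `s` steps the chain has law within `e` of `μ` in total variation, from `Leb`-almost every
initial point. The total variation distance is expressed by test functions with values in `[0, 1]`,
and the null set may depend on the test function. -/
def MixesWithin (κ : Kernel M M) (Leb μ : Measure M) (s : ℕ) (e : ℝ≥0∞) : Prop :=
  ∀ φ : M → ℝ≥0∞, Measurable φ → (∀ x, φ x ≤ 1) →
    ∀ᵐ x ∂Leb, ∫⁻ y, φ y ∂(κ ^ s) x ≤ ∫⁻ y, φ y ∂μ + e ∧ ∫⁻ y, φ y ∂μ ≤ ∫⁻ y, φ y ∂(κ ^ s) x + e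

theorem exists_lintegral_pow_mem_Icc [IsMarkovKernel κ] (hac : ∀ᵐ x ∂Leb, κ x ≪ Leb) {N : ℕ}
    {ν : Measure M} (hν : ∀ᵐ x ∂Leb, ν ≤ (κ ^ N) x)
    {φ : M → ℝ≥0∞} (hφ : Measurable φ) (hφ₁ : ∀ x, φ x ≤ 1) (k : ℕ) :
    ∃ a, ∀ᵐ x ∂Leb, ∫⁻ y, φ y ∂(κ ^ (N * k)) x ∈ Icc a (a + (1 - ν univ) ^ k) := by
  induction k with
  | zero =>
    refine ⟨0, .of_forall fun x => ?_⟩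
    simpa [kernel_one_apply, lintegral_dirac' _ hφ] using hφ₁ x
  | succ k ih =>
    obtain ⟨a, ha⟩ := ih
    refine ⟨∫⁻ y, ∫⁻ w, φ w ∂(κ ^ (N * k)) y ∂ν + a * (1 - ν univ), ?_⟩
    filter_upwards [hν, ae_ae_pow hac ha N] with x hx hxac
    rw [mul_add_one, lintegral_pow_add _ _ _ hφ, pow_succ]
    exact lintegral_mem_Icc_of_le hx hxac

theorem exists_mixesWithin_of_minorization [IsMarkovKernel κ] [IsProbabilityMeasure μ]
    (hac : ∀ᵐ x ∂Leb, κ x ≪ Leb) {N : ℕ}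
    {ν : Measure M} (hν₀ : ν ≠ 0) (hν : ∀ᵐ x ∂Leb, ν ≤ (κ ^ N) x)
    (hμ : κ.Invariant μ) (hμac : μ ≪ Leb) {e : ℝ≥0∞} (he : e ≠ 0) :
    ∃ s, MixesWithin κ Leb μ s e := by
  have hlt : 1 - ν univ < 1 := ENNReal.sub_lt_self (by simp) (by simp) (by simpa using hν₀)
  obtain ⟨k, hk⟩ := ((ENNReal.tendsto_pow_atTop_nhds_zero_of_lt_one hlt).eventually
    (gt_mem_nhds he.bot_lt)).exists
  refine ⟨N * k, fun φ hφ hφ₁ => ?_⟩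
  obtain ⟨a, ha⟩ := exists_lintegral_pow_mem_Icc hac hν hφ hφ₁ k
  have hmean : ∫⁻ y, φ y ∂μ ∈ Icc a (a + (1 - ν univ) ^ k) := by
    rw [← lintegral_invariant hφ (invariant_pow hμ (N * k))]
    constructor
    · simpa using lintegral_mono_ae (hμac (ha.mono fun _ h => h.1))
    · simpa using lintegral_mono_ae (hμac (ha.mono fun _ h => h.2))
  filter_upwards [ha] with x hx
  exact ⟨hx.2.trans (by gcongr; exact hmean.1),
    hmean.2.trans (by gcongr; exact hx.1)⟩

end Mixing

section Avoidance

variable {M : Type*} [MeasurableSpace M] {κ : Kernel M M} {Leb μ : Measure M} {B : Set M}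

/-- The probability that the chain with transition kernel `κ` started at `x` does not visit `B` at
the times `1, …, m`. -/
def avoidProb (κ : Kernel M M) (B : Set M) : ℕ → M → ℝ≥0∞
  | 0, _ => 1
  | m + 1, x => ∫⁻ y in Bᶜ, avoidProb κ B m y ∂κ x

theorem measurable_avoidProb [IsMarkovKernel κ] (hB : MeasurableSet B) (m : ℕ) :
    Measurable (avoidProb κ B m) := by
  induction m with
  | zero => exact measurable_const
  | succ m ih => exact ih.setLIntegral_kernel hB.compl

theorem avoidProb_le_one [IsMarkovKernel κ] (B : Set M) (m : ℕ) (x : M) :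
    avoidProb κ B m x ≤ 1 := by
  induction m generalizing x with
  | zero => exact le_rfl
  | succ m ih =>
    calc ∫⁻ y in Bᶜ, avoidProb κ B m y ∂κ x ≤ ∫⁻ _ in Bᶜ, 1 ∂κ x := lintegral_mono ih
      _ = κ x Bᶜ := setLIntegral_one _
      _ ≤ 1 := prob_le_one

theorem avoidProb_add_le [IsMarkovKernel κ] (hB : MeasurableSet B) (s m : ℕ) (x : M) :
    avoidProb κ B (m + s) x ≤ ∫⁻ y, avoidProb κ B m y ∂(κ ^ s) x := by
  have hmeas := measurable_avoidProb (κ := κ) hB m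
  induction s generalizing x with
  | zero => simp [kernel_one_apply, lintegral_dirac' _ hmeas]
  | succ s ih =>
    calc ∫⁻ y in Bᶜ, avoidProb κ B (m + s) y ∂κ x
        ≤ ∫⁻ y, avoidProb κ B (m + s) y ∂κ x := setLIntegral_le_lintegral _ _
      _ ≤ ∫⁻ y, ∫⁻ w, avoidProb κ B m w ∂(κ ^ s) y ∂κ x := lintegral_mono ih
      _ = ∫⁻ y, avoidProb κ B m y ∂(κ ^ (s + 1)) x := (lintegral_pow_succ κ s hmeas x).symm

theorem lintegral_avoidProb_pow_le [IsMarkovKernel κ] (hac : ∀ᵐ x ∂Leb, κ x ≪ Leb)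
    (hB : MeasurableSet B) {ε : ℝ≥0∞} (hε : ∀ᵐ x ∂Leb, κ x B ≤ ε) (s m : ℕ) :
    ∀ᵐ x ∂Leb, ∫⁻ y, avoidProb κ B m y ∂(κ ^ s) x ≤ avoidProb κ B (m + s) x + s * ε := by
  have hmeas := measurable_avoidProb (κ := κ) hB
  induction s with
  | zero => simp [kernel_one_apply, lintegral_dirac' _ (hmeas m)]
  | succ s ih =>
    filter_upwards [hac, hε] with x hx hxε
    have hsplit : ∫⁻ y, avoidProb κ B (m + s) y ∂κ x ≤ avoidProb κ B (m + (s + 1)) x + κ x B := by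
      rw [← lintegral_add_compl _ hB, add_comm]
      gcongr
      · exact le_rfl
      · simpa using lintegral_mono (μ := (κ x).restrict B) (avoidProb_le_one B (m + s))
    calc ∫⁻ y, avoidProb κ B m y ∂(κ ^ (s + 1)) x
        = ∫⁻ y, ∫⁻ w, avoidProb κ B m w ∂(κ ^ s) y ∂κ x := lintegral_pow_succ κ s (hmeas m) x
      _ ≤ ∫⁻ y, (avoidProb κ B (m + s) y + s * ε) ∂κ x := lintegral_mono_ae (hx ih)
      _ = ∫⁻ y, avoidProb κ B (m + s) y ∂κ x + s * ε := by
        rw [lintegral_add_right _ measurable_const, lintegral_const, measure_univ, mul_one]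
      _ ≤ avoidProb κ B (m + (s + 1)) x + κ x B + s * ε := by gcongr
      _ ≤ avoidProb κ B (m + (s + 1)) x + (s + 1 : ℕ) * ε := by
        rw [Nat.cast_add_one, add_one_mul, add_comm (s * ε), add_assoc]
        gcongr

theorem one_le_avoidProb_add [IsMarkovKernel κ] (hac : ∀ᵐ x ∂Leb, κ x ≪ Leb)
    (hB : MeasurableSet B) {ε : ℝ≥0∞} (hε : ∀ᵐ x ∂Leb, κ x B ≤ ε) (m : ℕ) :
    ∀ᵐ x ∂Leb, 1 ≤ avoidProb κ B m x + m * ε := by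
  filter_upwards [lintegral_avoidProb_pow_le hac hB hε m 0] with x hx
  simpa [avoidProb] using hx

theorem le_lintegral_add_of_ae_le [IsProbabilityMeasure μ] (hμac : μ ≪ Leb)
    {φ : M → ℝ≥0∞} {a b : ℝ≥0∞} (h : ∀ᵐ x ∂Leb, a ≤ φ x + b) : a ≤ ∫⁻ x, φ x ∂μ + b := by
  simpa [lintegral_add_right] using lintegral_mono_ae (hμac h)

theorem lintegral_le_add_of_ae_le [IsProbabilityMeasure μ] (hμac : μ ≪ Leb)
    {φ ψ : M → ℝ≥0∞} {b : ℝ≥0∞} (h : ∀ᵐ x ∂Leb, φ x ≤ ψ x + b) :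
    ∫⁻ x, φ x ∂μ ≤ ∫⁻ x, ψ x ∂μ + b := by
  simpa [lintegral_add_right] using lintegral_mono_ae (hμac h)

theorem lintegral_avoidProb_le_one [IsMarkovKernel κ] [IsProbabilityMeasure μ] (m : ℕ) :
    ∫⁻ x, avoidProb κ B m x ∂μ ≤ 1 := by
  simpa using lintegral_mono (μ := μ) (avoidProb_le_one (κ := κ) B m)

theorem MixesWithin.avoidProb_close [IsMarkovKernel κ] [IsProbabilityMeasure μ]
    {s : ℕ} {e : ℝ≥0∞} (hmix : MixesWithin κ Leb μ s e)
    (hac : ∀ᵐ x ∂Leb, κ x ≪ Leb) (hμ : κ.Invariant μ) (hμac : μ ≪ Leb)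
    (hB : MeasurableSet B) {ε : ℝ≥0∞} (hε : ∀ᵐ x ∂Leb, κ x B ≤ ε) (m : ℕ) :
    ∀ᵐ x ∂Leb, avoidProb κ B m x ≤ ∫⁻ y, avoidProb κ B m y ∂μ + (s * ε + e) ∧
      ∫⁻ y, avoidProb κ B m y ∂μ ≤ avoidProb κ B m x + (s * ε + e) := by
  have hmeas := measurable_avoidProb (κ := κ) hB
  rcases le_total m s with hms | hsm
  · have hone := one_le_avoidProb_add hac hB hε m
    have hbound : (m : ℝ≥0∞) * ε ≤ s * ε + e := le_add_right (by gcongr)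
    filter_upwards [hone] with x hx
    exact ⟨(avoidProb_le_one B m x).trans
        ((le_lintegral_add_of_ae_le hμac hone).trans (by gcongr)),
      (lintegral_avoidProb_le_one m).trans (hx.trans (by gcongr))⟩
  · obtain ⟨l, rfl⟩ := Nat.exists_eq_add_of_le' hsm
    have hupper : ∫⁻ y, avoidProb κ B (l + s) y ∂μ ≤ ∫⁻ y, avoidProb κ B l y ∂μ := by
      rw [← lintegral_invariant (hmeas l) (invariant_pow hμ s)]
      exact lintegral_mono (avoidProb_add_le hB s l)
    have hlower : ∫⁻ y, avoidProb κ B l y ∂μ ≤ ∫⁻ y, avoidProb κ B (l + s) y ∂μ + s * ε := by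
      rw [← lintegral_invariant (hmeas l) (invariant_pow hμ s)]
      exact lintegral_le_add_of_ae_le hμac (lintegral_avoidProb_pow_le hac hB hε s l)
    filter_upwards [lintegral_avoidProb_pow_le hac hB hε s l,
      hmix _ (hmeas l) (avoidProb_le_one B l)] with x hx hxs
    rw [← add_assoc, ← add_assoc]
    exact ⟨(avoidProb_add_le hB s l x).trans (hxs.1.trans (by gcongr)),
      hupper.trans (hxs.2.trans (by gcongr))⟩

theorem eventually_abs_lintegral_avoidProb_sub_le [IsMarkovKernel κ] [IsProbabilityMeasure μ]
    (hmix : ∀ e ≠ 0, ∃ s, MixesWithin κ Leb μ s e) (hμ : κ.Invariant μ) (hμac : μ ≪ Leb)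
    {C : ℝ≥0∞} (hC : C ≠ ⊤) (hκ : ∀ᵐ x ∂Leb, κ x ≤ C • Leb)
    {B : ℕ → Set M} (hB : ∀ n, MeasurableSet (B n))
    (hB₀ : Tendsto (fun n => Leb (B n)) atTop (𝓝 0))
    {ν : ℕ → Measure M} [∀ n, IsProbabilityMeasure (ν n)] (hν : ∀ n, ν n ≪ Leb)
    {e : ℝ} (he : 0 < e) :
    ∀ᶠ n in atTop, ∀ m, |(∫⁻ x, avoidProb κ (B n) m x ∂ν n).toReal -
      (∫⁻ x, avoidProb κ (B n) m x ∂μ).toReal| ≤ e := by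
  have he' : ENNReal.ofReal (e / 2) ≠ 0 := by simpa using he
  obtain ⟨s, hs⟩ := hmix _ he'
  have hsC : Tendsto (fun n => s * (C * Leb (B n))) atTop (𝓝 0) := by
    simpa using ENNReal.Tendsto.const_mul (a := (s : ℝ≥0∞))
      (ENNReal.Tendsto.const_mul hB₀ (.inr hC)) (.inr (by simp))
  filter_upwards [hsC.eventually (ge_mem_nhds he'.bot_lt)] with n hn m
  have hε : ∀ᵐ x ∂Leb, κ x (B n) ≤ C * Leb (B n) := hκ.mono fun x hx => hx (B n)
  have hac : ∀ᵐ x ∂Leb, κ x ≪ Leb := hκ.mono fun _ => Measure.absolutelyContinuous_of_le_smul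
  have hsum : s * (C * Leb (B n)) + ENNReal.ofReal (e / 2) ≤ ENNReal.ofReal e := by
    rw [← add_halves e, ENNReal.ofReal_add (half_pos he).le (half_pos he).le, add_halves]
    gcongr
  have hclose : ∀ᵐ x ∂Leb,
      avoidProb κ (B n) m x ≤ ∫⁻ y, avoidProb κ (B n) m y ∂μ + ENNReal.ofReal e ∧
      ∫⁻ y, avoidProb κ (B n) m y ∂μ ≤ avoidProb κ (B n) m x + ENNReal.ofReal e :=
    (hs.avoidProb_close hac hμ hμac (hB n) hε m).mono fun x hx =>
      ⟨hx.1.trans (by gcongr), hx.2.trans (by gcongr)⟩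
  have hfin : ∀ (ρ : Measure M) [IsProbabilityMeasure ρ],
      ∫⁻ x, avoidProb κ (B n) m x ∂ρ ≠ ⊤ := fun ρ _ =>
    ((lintegral_avoidProb_le_one m).trans_lt ENNReal.one_lt_top).ne
  have hupper : ∫⁻ x, avoidProb κ (B n) m x ∂ν n ≤
      ∫⁻ x, avoidProb κ (B n) m x ∂μ + ENNReal.ofReal e := by
    simpa using lintegral_le_add_of_ae_le (hν n) (ψ := fun _ => _)
      (hclose.mono fun _ hx => hx.1)
  have hlower : ∫⁻ x, avoidProb κ (B n) m x ∂μ ≤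
      ∫⁻ x, avoidProb κ (B n) m x ∂ν n + ENNReal.ofReal e :=
    le_lintegral_add_of_ae_le (hν n) (hclose.mono fun _ hx => hx.2)
  have hupper' := ENNReal.toReal_le_add hupper (hfin μ) ENNReal.ofReal_ne_top
  have hlower' := ENNReal.toReal_le_add hlower (hfin (ν n)) ENNReal.ofReal_ne_top
  rw [ENNReal.toReal_ofReal he.le] at hupper' hlower'
  exact abs_sub_le_iff.2 ⟨by linarith, by linarith⟩

end Avoidance

section PathSpace

variable {M : Type*} [MeasurableSpace M] {κ : Kernel M M} {Leb μ : Measure M}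
  {P : Measure (ℕ → M)} {B : Set M}

theorem measurable_pathShift : Measurable (pathShift (M := M)) :=
  measurable_pi_lambda _ fun n => measurable_pi_apply (n + 1)

theorem pathShift_iterate_apply {M : Type*} (j n : ℕ) (z : ℕ → M) :
    pathShift^[j] z n = z (n + j) := by
  induction j generalizing z with
  | zero => rfl
  | succ j ih => rw [Function.iterate_succ_apply, ih, pathShift, add_assoc]

theorem IsMarkovChainLaw.setLIntegral_step (hP : IsMarkovChainLaw (fun x => κ x) μ P)
    {n : ℕ} {A : Set (Fin (n + 1) → M)} (hA : MeasurableSet A) {φ : M → ℝ≥0∞}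
    (hφ : Measurable φ) :
    ∫⁻ z in {z | (fun i : Fin (n + 1) => z i) ∈ A}, φ (z (n + 1)) ∂P =
      ∫⁻ z in {z | (fun i : Fin (n + 1) => z i) ∈ A}, ∫⁻ y, φ y ∂κ (z n) ∂P := by
  set E : Set (ℕ → M) := {z | (fun i : Fin (n + 1) => z i) ∈ A}
  have hκn : AEMeasurable (fun z : ℕ → M => κ (z n)) (P.restrict E) :=
    (κ.measurable.comp (measurable_pi_apply n)).aemeasurable
  have hmap : (P.restrict E).map (fun z => z (n + 1)) = (P.restrict E).bind fun z => κ (z n) := by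
    ext B hB
    rw [Measure.map_apply (measurable_pi_apply _) hB, Measure.bind_apply hB hκn,
      Measure.restrict_apply (measurable_pi_apply _ hB), ← hP.step n A B hA hB, inter_comm]
    rfl
  rw [← lintegral_map hφ (measurable_pi_apply (n + 1)), hmap,
    Measure.lintegral_bind hκn hφ.aemeasurable]

theorem IsMarkovChainLaw.measure_avoid (hP : IsMarkovChainLaw (fun x => κ x) μ P)
    [IsMarkovKernel κ] (hB : MeasurableSet B) (m : ℕ) {n : ℕ} {A : Set (Fin (n + 1) → M)}
    (hA : MeasurableSet A) :
    P {z | (fun i : Fin (n + 1) => z i) ∈ A ∧ ∀ j, 1 ≤ j → j ≤ m → z (n + j) ∉ B} =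
      ∫⁻ z in {z | (fun i : Fin (n + 1) => z i) ∈ A}, avoidProb κ B m (z n) ∂P := by
  induction m generalizing n with
  | zero =>
    simp only [avoidProb, setLIntegral_one]
    congr 1
    ext z
    exact and_iff_left fun j h₁ h₀ => by omega
  | succ m ih =>
    let A' : Set (Fin (n + 2) → M) :=
      (fun a i => a (Fin.castSucc i)) ⁻¹' A ∩ (fun a => a (Fin.last _)) ⁻¹' Bᶜ
    have hA' : MeasurableSet A' :=
      (measurable_pi_lambda _ (fun i => measurable_pi_apply _) hA).inter
        (measurable_pi_apply _ hB.compl)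
    have hset : {z : ℕ → M | (fun i : Fin (n + 1) => z i) ∈ A ∧
        ∀ j, 1 ≤ j → j ≤ m + 1 → z (n + j) ∉ B} =
        {z | (fun i : Fin (n + 2) => z i) ∈ A' ∧ ∀ j, 1 ≤ j → j ≤ m → z (n + 1 + j) ∉ B} := by
      ext z
      simp only [A', mem_ofPred_eq, mem_inter_iff, mem_preimage, mem_compl_iff, and_assoc]
      refine and_congr_right fun _ => ⟨fun h => ⟨h 1 le_rfl (by simp), fun j h₁ hj => ?_⟩, ?_⟩
      · rw [add_assoc]
        exact h _ (by omega) (by omega)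
      · rintro ⟨hn, h⟩ j h₁ hj
        rcases h₁.eq_or_lt with rfl | h₁
        · exact hn
        · simpa [show n + 1 + (j - 1) = n + j by omega] using h (j - 1) (by omega) (by omega)
    have hcyl : {z : ℕ → M | (fun i : Fin (n + 2) => z i) ∈ A'} =
        (fun z => z (n + 1)) ⁻¹' Bᶜ ∩ {z | (fun i : Fin (n + 1) => z i) ∈ A} := by
      rw [inter_comm]; rfl
    have hφ := (measurable_avoidProb (κ := κ) hB m).indicator hB.compl
    calc P {z | (fun i : Fin (n + 1) => z i) ∈ A ∧ ∀ j, 1 ≤ j → j ≤ m + 1 → z (n + j) ∉ B}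
        = ∫⁻ z in {z | (fun i : Fin (n + 2) => z i) ∈ A'}, avoidProb κ B m (z (n + 1)) ∂P := by
          rw [hset, ih hA']
      _ = ∫⁻ z in {z | (fun i : Fin (n + 1) => z i) ∈ A},
            Bᶜ.indicator (avoidProb κ B m) (z (n + 1)) ∂P := by
          rw [hcyl, ← setLIntegral_indicator (measurable_pi_apply _ hB.compl)]
          rfl
      _ = ∫⁻ z in {z | (fun i : Fin (n + 1) => z i) ∈ A}, avoidProb κ B (m + 1) (z n) ∂P := by
          rw [hP.setLIntegral_step hA hφ]
          simp only [lintegral_indicator hB.compl, avoidProb]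

theorem IsMarkovChainLaw.measure_inter_survivalSet (hP : IsMarkovChainLaw (fun x => κ x) μ P)
    [IsMarkovKernel κ] (hB : MeasurableSet B) {D : Set M} (hD : MeasurableSet D) (m : ℕ) :
    P ({z | z 0 ∈ D} ∩ survivalSet pathShift {z | z 0 ∈ B} m) =
      ∫⁻ x in D, avoidProb κ B m x ∂μ := by
  have hset : {z : ℕ → M | z 0 ∈ D} ∩ survivalSet pathShift {z | z 0 ∈ B} m =
      {z | (fun i : Fin 1 => z i) ∈ {a : Fin 1 → M | a 0 ∈ D} ∧
        ∀ j, 1 ≤ j → j ≤ m → z (0 + j) ∉ B} := by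
    ext z
    simp [survivalSet, pathShift_iterate_apply]
  rw [hset, hP.measure_avoid hB m (A := {a | a 0 ∈ D}) (measurable_pi_apply 0 hD), ← hP.init,
    setLIntegral_map hD (measurable_avoidProb hB m) (measurable_pi_apply 0)]
  rfl

theorem tendsto_measure_zero_of_absolutelyContinuous [IsFiniteMeasure Leb] [IsFiniteMeasure μ]
    (hμac : μ ≪ Leb) {B : ℕ → Set M} (hB_lim : Tendsto (fun n => Leb (B n)) atTop (𝓝 0)) :
    Tendsto (fun n => μ (B n)) atTop (𝓝 0) := by
  simp only [← Measure.setLIntegral_rnDeriv hμac]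
  exact tendsto_setLIntegral_zero (Measure.lintegral_rnDeriv_lt_top μ Leb).ne hB_lim

theorem IsMarkovChainLaw.measure_survivalSet_succ (hP : IsMarkovChainLaw (fun x => κ x) μ P)
    [IsMarkovKernel κ] (hμ : κ.Invariant μ) (hB : MeasurableSet B) (m : ℕ) :
    P (survivalSet pathShift {z | z 0 ∈ B} (m + 1)) =
      P (survivalSet pathShift {z | z 0 ∈ B} m \ {z | z 0 ∈ B}) := by
  have hA := measurable_avoidProb (κ := κ) hB m
  calc P (survivalSet pathShift {z | z 0 ∈ B} (m + 1))
      = ∫⁻ x, avoidProb κ B (m + 1) x ∂μ := by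
        simpa using hP.measure_inter_survivalSet hB .univ (m + 1)
    _ = ∫⁻ x in Bᶜ, avoidProb κ B m x ∂μ := by
        simp only [avoidProb, ← lintegral_indicator hB.compl]
        exact lintegral_invariant (hA.indicator hB.compl) hμ
    _ = P (survivalSet pathShift {z | z 0 ∈ B} m \ {z | z 0 ∈ B}) := by
        rw [Set.sdiff_eq, inter_comm, ← hP.measure_inter_survivalSet hB hB.compl]
        rfl

theorem IsMarkovChainLaw.measure_initial (hP : IsMarkovChainLaw (fun x => κ x) μ P)
    (hB : MeasurableSet B) : P {z | z 0 ∈ B} = μ B := by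
  rw [← hP.init, Measure.map_apply (measurable_pi_apply 0) hB]
  rfl

theorem IsMarkovChainLaw.cond_survivalSet (hP : IsMarkovChainLaw (fun x => κ x) μ P)
    [IsMarkovKernel κ] (hB : MeasurableSet B) (m : ℕ) :
    P[survivalSet pathShift {z | z 0 ∈ B} m | {z | z 0 ∈ B}] =
      ∫⁻ x, avoidProb κ B m x ∂μ[|B] := by
  rw [cond_apply (s := {z : ℕ → M | z 0 ∈ B}) (measurable_pi_apply 0 hB),
    hP.measure_inter_survivalSet hB hB,
    hP.measure_initial hB, ProbabilityTheory.cond, lintegral_smul_measure, smul_eq_mul]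

theorem IsMarkovChainLaw.hasExponentialHTSRTS [IsProbabilityMeasure P] [IsProbabilityMeasure μ]
    [IsFiniteMeasure Leb] [IsMarkovKernel κ] (hP : IsMarkovChainLaw (fun x => κ x) μ P)
    (hmix : ∀ e ≠ 0, ∃ s, MixesWithin κ Leb μ s e) (hμ : κ.Invariant μ) (hμac : μ ≪ Leb)
    {C : ℝ≥0∞} (hC : C ≠ ⊤) (hκ : ∀ᵐ x ∂Leb, κ x ≤ C • Leb)
    {B : ℕ → Set M} (hB : ∀ n, MeasurableSet (B n)) (hB_pos : ∀ n, μ (B n) ≠ 0)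
    (hB_lim : Tendsto (fun n => Leb (B n)) atTop (𝓝 0)) :
    HasExponentialHTSRTS P pathShift (fun n => {z | z 0 ∈ B n}) := by
  have hrare : IsRareSequence P (fun n => {z | z 0 ∈ B n}) := by
    refine ⟨fun n => measurable_pi_apply 0 (hB n), fun n => ?_, ?_⟩
    · rw [hP.measure_initial (hB n)]
      exact (hB_pos n).bot_lt
    · simpa only [hP.measure_initial (hB _)] using
        tendsto_measure_zero_of_absolutelyContinuous hμac hB_lim
  refine hasExponentialHTSRTS_of_survivalSet measurable_pathShift hrare
    (fun n => hP.measure_survivalSet_succ hμ (hB n)) fun e he => ?_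
  have hcond (n : ℕ) : IsProbabilityMeasure μ[|B n] := cond_isProbabilityMeasure (hB_pos n)
  filter_upwards [eventually_abs_lintegral_avoidProb_sub_le hmix hμ hμac hC hκ hB hB_lim
    (ν := fun n => μ[|B n]) (fun n => cond_absolutelyContinuous.trans hμac) he] with n hn m
  have huncond : P (survivalSet pathShift {z | z 0 ∈ B n} m) = ∫⁻ x, avoidProb κ (B n) m x ∂μ := by
    simpa using hP.measure_inter_survivalSet (hB n) .univ m
  rw [measureReal_def, measureReal_def, hP.cond_survivalSet (hB n), huncond]
  exact hn m

end PathSpace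

section RandomOrbit

variable {M X : Type*} [MeasurableSpace M] [MeasurableSpace X] {F : M → X → M}
  {θ : Measure X} {μ : Measure M}

/-- The random orbit `n ↦ (f_{ω_n} ∘ ⋯ ∘ f_{ω_1}) x` of the point `z = (x, ω)`, which makes
path space with its shift a factor of the skew product. -/
def randomOrbit {M X : Type*} (F : M → X → M) (z : M × (ℕ → X)) (n : ℕ) : M :=
  ((skewProduct F)^[n] z).1

theorem skewProduct_iterate_snd {M X : Type*} (F : M → X → M) (z : M × (ℕ → X)) (n i : ℕ) :
    ((skewProduct F)^[n] z).2 i = z.2 (i + n) := by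
  induction n generalizing z with
  | zero => rfl
  | succ n ih => simp only [Function.iterate_succ_apply, ih, skewProduct, add_assoc]

theorem randomOrbit_succ {M X : Type*} (F : M → X → M) (z : M × (ℕ → X)) (n : ℕ) :
    randomOrbit F z (n + 1) = F (randomOrbit F z n) (z.2 n) := by
  rw [randomOrbit, Function.iterate_succ_apply', skewProduct, skewProduct_iterate_snd, zero_add]
  rfl

theorem semiconj_randomOrbit {M X : Type*} (F : M → X → M) :
    Function.Semiconj (randomOrbit F) (skewProduct F) pathShift := fun _ => rfl

theorem measurable_skewProduct (hF : Measurable (Function.uncurry F)) :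
    Measurable (skewProduct F) :=
  (hF.comp (measurable_fst.prodMk ((measurable_pi_apply 0).comp measurable_snd))).prodMk
    (measurable_pi_lambda _ fun n => (measurable_pi_apply (n + 1)).comp measurable_snd)

theorem measurable_randomOrbit (hF : Measurable (Function.uncurry F)) :
    Measurable (randomOrbit F) :=
  measurable_pi_lambda _ fun n => measurable_fst.comp ((measurable_skewProduct hF).iterate n)

theorem measurable_transition (hF : Measurable (Function.uncurry F)) (θ : Measure X) [SFinite θ]
    {B : Set M} (hB : MeasurableSet B) : Measurable fun x => transition F θ x B := by
  simp only [transition, Measure.map_apply hF.of_uncurry_left hB]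
  exact measurable_measure_prodMk_left (hF hB)

/-- The transition probabilities of the random maps, as a kernel. -/
def transitionKernel (hF : Measurable (Function.uncurry F)) (θ : Measure X) [SFinite θ] :
    Kernel M M where
  toFun := transition F θ
  measurable' := Measure.measurable_of_measurable_coe _ fun _ hB => measurable_transition hF θ hB

theorem isMarkovKernel_transitionKernel (hF : Measurable (Function.uncurry F))
    [IsProbabilityMeasure θ] : IsMarkovKernel (transitionKernel hF θ) :=
  ⟨fun _ => Measure.isProbabilityMeasure_map hF.of_uncurry_left.aemeasurable⟩

theorem indepFun_randomOrbit_noise [IsProbabilityMeasure θ] (hF : Measurable (Function.uncurry F))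
    (x : M) (n : ℕ) :
    IndepFun (fun ξ (i : Fin (n + 1)) => randomOrbit F (x, ξ) i) (fun ξ => ξ n)
      (Measure.infinitePi fun _ : ℕ => θ) := by
  let noise (i : ℕ) : MeasurableSpace (ℕ → X) := MeasurableSpace.comap (fun ξ => ξ i) inferInstance
  let past : MeasurableSpace (ℕ → X) := ⨆ i ∈ Iio n, noise i
  have hnoise (i : ℕ) (hi : i < n) : Measurable[past] fun ξ : ℕ → X => ξ i :=
    Measurable.of_comap_le (le_iSup₂_of_le (f := fun i (_ : i ∈ Iio n) => noise i) i hi le_rfl)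
  have horbit (j : ℕ) (hj : j ≤ n) : Measurable[past] fun ξ => randomOrbit F (x, ξ) j := by
    induction j with
    | zero => exact measurable_const
    | succ j ih =>
      simp only [randomOrbit_succ]
      exact hF.comp ((ih (by omega)).prodMk (hnoise j (by omega)))
  have hiIndep : iIndep noise (Measure.infinitePi fun _ : ℕ => θ) :=
    iIndepFun_infinitePi (X := fun _ : ℕ => id) fun _ => measurable_id
  have hindep := indep_iSup_of_disjoint (fun i => (measurable_pi_apply i).comap_le) hiIndep
    (S := Iio n) (T := {n}) (by simp)
  refine indep_of_indep_of_le_right (indep_of_indep_of_le_left hindep ?_) (by simp)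
  exact (measurable_pi_lambda _ fun i : Fin (n + 1) => horbit i (by omega)).comap_le

theorem infinitePi_randomOrbit_step [IsProbabilityMeasure θ]
    (hF : Measurable (Function.uncurry F)) (x : M) {n : ℕ} {A : Set (Fin (n + 1) → M)}
    (hA : MeasurableSet A) {B : Set M} (hB : MeasurableSet B) :
    Measure.infinitePi (fun _ : ℕ => θ) {ξ | (fun i : Fin (n + 1) => randomOrbit F (x, ξ) i) ∈ A ∧
        randomOrbit F (x, ξ) (n + 1) ∈ B} =
      ∫⁻ ξ in {ξ | (fun i : Fin (n + 1) => randomOrbit F (x, ξ) i) ∈ A},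
        transition F θ (randomOrbit F (x, ξ) n) B ∂(Measure.infinitePi fun _ : ℕ => θ) := by
  set Q : Measure (ℕ → X) := Measure.infinitePi fun _ : ℕ => θ
  set G : (ℕ → X) → Fin (n + 1) → M := fun ξ i => randomOrbit F (x, ξ) i
  have hG : Measurable G := measurable_pi_lambda _ fun i =>
    (measurable_pi_apply (i : ℕ)).comp ((measurable_randomOrbit hF).comp measurable_prodMk_left)
  have hprod : Q.map (fun ξ => (G ξ, ξ n)) = (Q.map G).prod θ := by
    rw [(indepFun_iff_map_prod_eq_prod_map_map hG.aemeasurable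
      (measurable_pi_apply n).aemeasurable).1 (indepFun_randomOrbit_noise hF x n)]
    congr 1
    exact (measurePreserving_eval_infinitePi (fun _ : ℕ => θ) n).map_eq
  let E : Set ((Fin (n + 1) → M) × X) := {p | p.1 ∈ A ∧ F (p.1 (Fin.last n)) p.2 ∈ B}
  have hlast : Measurable fun a : Fin (n + 1) → M => a (Fin.last n) := measurable_pi_apply _
  have hE : MeasurableSet E :=
    (measurable_fst hA).inter (hF.comp ((hlast.comp measurable_fst).prodMk measurable_snd) hB)
  have hslice (a : Fin (n + 1) → M) : θ (Prod.mk a ⁻¹' E) =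
      A.indicator (fun a => transition F θ (a (Fin.last n)) B) a := by
    by_cases ha : a ∈ A
    · rw [indicator_of_mem ha, transition, Measure.map_apply hF.of_uncurry_left hB]
      exact congrArg θ (ext fun ξ => and_iff_right ha)
    · simp [E, ha]
  have hevent : {ξ | G ξ ∈ A ∧ randomOrbit F (x, ξ) (n + 1) ∈ B} =
      (fun ξ => (G ξ, ξ n)) ⁻¹' E := by
    simp only [randomOrbit_succ]
    rfl
  rw [hevent, ← Measure.map_apply (hG.prodMk (measurable_pi_apply n)) hE, hprod,
    Measure.prod_apply hE]
  simp only [hslice]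
  rw [lintegral_indicator hA]
  exact setLIntegral_map hA ((measurable_transition hF θ hB).comp hlast) hG

instance isProbabilityMeasure_annealed [IsProbabilityMeasure θ] [IsProbabilityMeasure μ] :
    IsProbabilityMeasure (annealed μ θ) := by
  unfold annealed
  infer_instance

theorem isMarkovChainLaw_map_randomOrbit [IsProbabilityMeasure θ] [IsProbabilityMeasure μ]
    (hF : Measurable (Function.uncurry F)) :
    IsMarkovChainLaw (transition F θ) μ ((annealed μ θ).map (randomOrbit F)) := by
  have hΦ := measurable_randomOrbit hF
  refine ⟨?_, fun n A B hA hB => ?_⟩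
  · rw [Measure.map_map (measurable_pi_apply 0) hΦ]
    exact Measure.map_fst_prod.trans (by simp)
  have hA' : MeasurableSet {z : ℕ → M | (fun i : Fin (n + 1) => z i) ∈ A} :=
    measurable_pi_lambda _ (fun i => measurable_pi_apply _) hA
  have hB' : MeasurableSet {z : ℕ → M | z (n + 1) ∈ B} := measurable_pi_apply (n + 1) hB
  have hκ : Measurable fun z : ℕ → M => transition F θ (z n) B :=
    (measurable_transition hF θ hB).comp (measurable_pi_apply n)
  have hκΦ : Measurable fun z => transition F θ (randomOrbit F z n) B := hκ.comp hΦ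
  rw [ofPred_and, setLIntegral_map hA' hκ hΦ, Measure.map_apply hΦ (hA'.inter hB'), annealed,
    Measure.prod_apply (hΦ (hA'.inter hB')), ← lintegral_indicator (hΦ hA'),
    lintegral_prod _ (hκΦ.indicator (hΦ hA')).aemeasurable]
  refine lintegral_congr fun x => ?_
  have hslice : MeasurableSet {ξ | (fun i : Fin (n + 1) => randomOrbit F (x, ξ) i) ∈ A} :=
    measurable_prodMk_left (hΦ hA')
  exact (infinitePi_randomOrbit_step hF x hA hB).trans (lintegral_indicator hslice _).symm

theorem hasExponentialHTSRTS_skewProduct [IsProbabilityMeasure θ] [IsProbabilityMeasure μ]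
    (hF : Measurable (Function.uncurry F)) {B : ℕ → Set M}
    (h : ∀ (P : Measure (ℕ → M)) [IsProbabilityMeasure P], IsMarkovChainLaw (transition F θ) μ P →
      HasExponentialHTSRTS P pathShift fun n => {z | z 0 ∈ B n}) :
    HasExponentialHTSRTS (annealed μ θ) (skewProduct F)
      fun n => B n ×ˢ (univ : Set (ℕ → X)) := by
  have := Measure.isProbabilityMeasure_map (μ := annealed μ θ)
    (measurable_randomOrbit hF).aemeasurable
  have hV (n : ℕ) : B n ×ˢ (univ : Set (ℕ → X)) = randomOrbit F ⁻¹' {z | z 0 ∈ B n} := by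
    ext z
    exact and_iff_left (mem_univ _)
  simp only [hV]
  exact (h _ (isMarkovChainLaw_map_randomOrbit hF)).of_semiconj measurable_pathShift
    ⟨measurable_randomOrbit hF, rfl⟩ (semiconj_randomOrbit F)

end RandomOrbit

section PseudoOrbits

theorem eventually_mem_of_setGcd_eq_one (L : AddSubmonoid ℕ) (h : Nat.setGcd (L : Set ℕ) = 1) :
    ∀ᶠ k in atTop, k ∈ L := by
  obtain ⟨n, hn⟩ := Nat.exists_mem_closure_of_ge (L : Set ℕ)
  rw [AddSubmonoid.closure_eq] at hn
  filter_upwards [eventually_ge_atTop n] with k hk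
  exact hn k hk (h ▸ one_dvd k)

theorem frequently_mem_of_denseRange {M : Type*} [TopologicalSpace M] [T1Space M]
    [ConnectedSpace M] {z : ℕ → M} (hz : DenseRange z) {U : Set M} (hU : IsOpen U)
    (hU' : U.Nonempty) : ∃ᶠ j in atTop, z j ∈ U := by
  rw [frequently_atTop]
  intro n
  rcases subsingleton_or_nontrivial M with _ | _
  · obtain ⟨p, hp⟩ := hU'
    exact ⟨n, le_rfl, Subsingleton.elim p (z n) ▸ hp⟩
  · obtain ⟨_, hpU, ⟨j, rfl⟩, hj⟩ :=
      (Dense.sdiff_finite hz ((finite_lt_nat n).image z)).inter_open_nonempty U hU hU'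
    exact ⟨j, not_lt.1 fun hlt => hj (mem_image_of_mem z hlt), hpU⟩

variable {M : Type*} [MetricSpace M] {z : ℕ → M} {η : ℝ} {i j k l m : ℕ}

/-- `PseudoOrbit z η k i j`: there are indices `i = i₀, i₁, …, i_k = j` such that `z i_{m+1}` is
`η`-close to `z (i_m + 1)`, the successor of `z i_m`. -/
inductive PseudoOrbit (z : ℕ → M) (η : ℝ) : ℕ → ℕ → ℕ → Prop
  | refl (i : ℕ) : PseudoOrbit z η 0 i i
  | step {k i j l : ℕ} : PseudoOrbit z η k i j → dist (z (j + 1)) (z l) < η →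
      PseudoOrbit z η (k + 1) i l

namespace PseudoOrbit

theorem trans (h₁ : PseudoOrbit z η k i j) (h₂ : PseudoOrbit z η l j m) :
    PseudoOrbit z η (k + l) i m := by
  induction h₂ with
  | refl => exact h₁
  | step _ hd ih => exact (ih h₁).step hd

theorem add_right (hη : 0 < η) (i k : ℕ) : PseudoOrbit z η k i (i + k) := by
  induction k with
  | zero => exact .refl i
  | succ k ih => exact ih.step (by simpa [add_assoc] using hη)

/-- The lengths of the pseudo-orbits from `z i` to itself. -/
def loops (z : ℕ → M) (η : ℝ) (i : ℕ) : AddSubmonoid ℕ where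
  carrier := {k | PseudoOrbit z η k i i}
  zero_mem' := .refl i
  add_mem' := trans

variable [ConnectedSpace M]

theorem exists_length (hz : DenseRange z) (hη : 0 < η) (i j : ℕ) :
    ∃ k, PseudoOrbit z η k i j := by
  obtain ⟨l, hl, hlj⟩ := frequently_atTop.1
    (frequently_mem_of_denseRange hz Metric.isOpen_ball ⟨z j, Metric.mem_ball_self hη⟩) (i + 1)
  obtain ⟨k, rfl⟩ := Nat.exists_eq_add_of_le hl
  exact ⟨k + 1, (add_right hη i k).step (by rwa [add_right_comm])⟩

theorem natCast_length_eq (hz : DenseRange z) (hη : 0 < η) (h : PseudoOrbit z η k 0 i) :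
    (k : ZMod (Nat.setGcd (loops z η 0 : Set ℕ))) = i := by
  obtain ⟨l, hl⟩ := exists_length hz hη i 0
  have hloop {m : ℕ} (hm : PseudoOrbit z η m 0 i) :
      ((m + l : ℕ) : ZMod (Nat.setGcd (loops z η 0 : Set ℕ))) = 0 :=
    (ZMod.natCast_eq_zero_iff _ _).2 (Nat.setGcd_dvd_of_mem (hm.trans hl))
  have := (hloop h).trans (hloop (by simpa using add_right hη 0 i)).symm
  simpa using this

theorem setGcd_loops_eq_one (hz : DenseRange z) (hη : 0 < η) :
    Nat.setGcd (loops z η 0 : Set ℕ) = 1 := by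
  set g := Nat.setGcd (loops z η 0 : Set ℕ)
  have hnear {a b : ℕ} (ha : 1 ≤ a) (hab : dist (z a) (z b) < η) : (a : ZMod g) = b := by
    obtain ⟨a, rfl⟩ := Nat.exists_eq_add_of_le' ha
    exact natCast_length_eq hz hη ((by simpa using add_right hη 0 a :
      PseudoOrbit z η a 0 a).step hab)
  have hvisit (p : M) : ∃ a, 1 ≤ a ∧ dist (z a) p < η / 4 :=
    frequently_atTop.1 (frequently_mem_of_denseRange hz Metric.isOpen_ball
      ⟨p, Metric.mem_ball_self (by positivity)⟩) 1
  choose a ha_one ha using hvisit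
  have hconst : IsLocallyConstant fun p => (a p : ZMod g) := by
    refine (IsLocallyConstant.iff_eventually_eq _).2 fun p => ?_
    filter_upwards [Metric.ball_mem_nhds p (by positivity : 0 < η / 4)] with q hq
    refine hnear (ha_one q) ?_
    have := dist_triangle4_right (z (a q)) (z (a p)) q p
    linarith [ha p, ha q, Metric.mem_ball.1 hq]
  have hval (n : ℕ) : (a (z n) : ZMod g) = n :=
    hnear (ha_one _) ((ha _).trans (by linarith))
  have h12 : ((1 : ℕ) : ZMod g) = (2 : ℕ) := by
    rw [← hval 1, ← hval 2]
    exact hconst.apply_eq_of_preconnectedSpace _ _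
  have : ((1 : ℕ) : ZMod g) = 0 := by simpa [← one_add_one_eq_two] using h12
  exact Nat.dvd_one.1 ((ZMod.natCast_eq_zero_iff _ _).1 this)

theorem eventually_of_denseRange (hz : DenseRange z) (hη : 0 < η) (i j : ℕ) :
    ∀ᶠ k in atTop, PseudoOrbit z η k i j := by
  obtain ⟨k₁, h₁⟩ := exists_length hz hη i 0
  obtain ⟨k₂, h₂⟩ := exists_length hz hη 0 j
  have hloops := eventually_mem_of_setGcd_eq_one (loops z η 0) (setGcd_loops_eq_one hz hη)
  filter_upwards [(tendsto_sub_atTop_nat (k₁ + k₂)).eventually hloops,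
    eventually_ge_atTop (k₁ + k₂)] with k hk hle
  have h := (h₁.trans hk).trans h₂
  rwa [show k₁ + (k - (k₁ + k₂)) + k₂ = k by omega] at h

end PseudoOrbit

end PseudoOrbits

section Reachability

variable {M : Type*} [MeasurableSpace M] {κ : Kernel M M} {Leb μ : Measure M}
  {U V W : Set M} {k l : ℕ}

/-- From almost every point of `U`, the `k`-step transition probabilities dominate a fixed
positive multiple of the reference measure on `V`. -/
def Reaches (κ : Kernel M M) (Leb : Measure M) (k : ℕ) (U V : Set M) : Prop :=
  ∃ c : ℝ≥0∞, c ≠ 0 ∧ ∀ᵐ x ∂Leb, x ∈ U → c • Leb.restrict V ≤ (κ ^ k) x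

theorem Reaches.mono_left (h : Reaches κ Leb k V W) (hUV : ∀ᵐ x ∂Leb, x ∈ U → x ∈ V) :
    Reaches κ Leb k U W := by
  obtain ⟨c, hc, h⟩ := h
  refine ⟨c, hc, ?_⟩
  filter_upwards [h, hUV] with x hx hxUV hxU using hx (hxUV hxU)

theorem Reaches.trans (h₁ : Reaches κ Leb k U V) (h₂ : Reaches κ Leb l V W) (hV : Leb V ≠ 0) :
    Reaches κ Leb (k + l) U W := by
  obtain ⟨c, hc, h₁⟩ := h₁
  obtain ⟨c', hc', h₂⟩ := h₂
  refine ⟨c * (Leb V * c'), mul_ne_zero hc (mul_ne_zero hV hc'), ?_⟩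
  filter_upwards [h₁] with x hx hxU
  refine Measure.le_iff.2 fun A hA => ?_
  calc (c * (Leb V * c')) • Leb.restrict W A
      = c * ∫⁻ _ in V, c' * Leb.restrict W A ∂Leb := by
        rw [setLIntegral_const, smul_eq_mul]
        ring
    _ ≤ c * ∫⁻ y in V, (κ ^ l) y A ∂Leb := by
        gcongr c * ?_
        refine setLIntegral_mono_ae ((κ ^ l).measurable_coe hA).aemeasurable ?_
        filter_upwards [h₂] with y hy hyV using hy hyV A
    _ = ∫⁻ y, (κ ^ l) y A ∂(c • Leb.restrict V) := by rw [lintegral_smul_measure, smul_eq_mul]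
    _ ≤ ∫⁻ y, (κ ^ l) y A ∂(κ ^ k) x := lintegral_mono' (hx hxU) le_rfl
    _ = (κ ^ (k + l)) x A := (Kernel.pow_add_apply_eq_lintegral κ k l x hA).symm

theorem Reaches.biUnion {ι : Type*} {t : Finset ι} {U : ι → Set M}
    (h : ∀ i ∈ t, Reaches κ Leb k (U i) V) : Reaches κ Leb k (⋃ i ∈ t, U i) V := by
  choose! c hc h using h
  have hinf : 0 < t.inf c := (Finset.lt_inf_iff ENNReal.zero_lt_top).2 fun i hi => (hc i hi).bot_lt
  refine ⟨t.inf c, hinf.ne', ?_⟩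
  filter_upwards [(Filter.eventually_all_finset t).2 h] with x hx hxU
  obtain ⟨i, hi, hxi⟩ := mem_iUnion₂.1 hxU
  refine (Measure.le_iff'.2 fun A => ?_).trans (hx i hi hxi)
  exact mul_le_mul_left (Finset.inf_le hi) _

theorem Reaches.exists_smul_restrict_le [IsProbabilityMeasure μ]
    (h : Reaches κ Leb k univ V) (hμ : κ.Invariant μ) (hμac : μ ≪ Leb) :
    ∃ c : ℝ≥0∞, c ≠ 0 ∧ c • Leb.restrict V ≤ μ := by
  obtain ⟨c, hc, h⟩ := h
  refine ⟨c, hc, Measure.le_iff.2 fun A hA => ?_⟩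
  calc (c • Leb.restrict V) A = ∫⁻ _, (c • Leb.restrict V) A ∂μ := by simp
    _ ≤ ∫⁻ x, (κ ^ k) x A ∂μ :=
        lintegral_mono_ae (hμac.ae_le (h.mono fun x hx => hx (mem_univ x) A))
    _ = μ A := by
        rw [← Measure.bind_apply hA (κ ^ k).aemeasurable, (invariant_pow hμ k).def]

variable [MetricSpace M] {f : M → M} {z : ℕ → M} {η ρ : ℝ}

theorem reaches_one_of_subset_ball {c : ℝ≥0∞} (hc : c ≠ 0)
    (hκ : ∀ᵐ x ∂Leb, c • Leb.restrict (Metric.ball (f x) ρ) ≤ κ x)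
    (h : ∀ x ∈ U, V ⊆ Metric.ball (f x) ρ) : Reaches κ Leb 1 U V := by
  refine ⟨c, hc, ?_⟩
  filter_upwards [hκ] with x hx hxU
  rw [pow_one]
  exact le_trans (by gcongr; exact h x hxU) hx

theorem Reaches.trans_pseudoOrbit {W : ℕ → Set M} {i j : ℕ} (h : Reaches κ Leb l U (W i))
    (hW : ∀ i, Leb (W i) ≠ 0)
    (hstep : ∀ i j, dist (z (i + 1)) (z j) < η → Reaches κ Leb 1 (W i) (W j))
    (hij : PseudoOrbit z η k i j) : Reaches κ Leb (l + k) U (W j) := by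
  induction hij with
  | refl => exact h
  | step _ hd ih => simpa only [add_assoc] using (ih h).trans (hstep _ _ hd) (hW _)

theorem eventually_reaches_univ [CompactSpace M] [ConnectedSpace M] (hz : DenseRange z)
    (hη : 0 < η) {W : ℕ → Set M} (hW : ∀ i, Leb (W i) ≠ 0)
    (hstep : ∀ i j, dist (z (i + 1)) (z j) < η → Reaches κ Leb 1 (W i) (W j)) (hρ : 0 < ρ)
    (hcover : ∀ j, Reaches κ Leb 1 (f ⁻¹' Metric.ball (z j) ρ) (W j)) (i : ℕ) :
    ∀ᶠ k in atTop, Reaches κ Leb k univ (W i) := by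
  obtain ⟨t, ht⟩ := isCompact_univ.elim_finite_subcover (fun j => Metric.ball (z j) ρ)
    (fun _ => Metric.isOpen_ball) fun p _ => mem_iUnion.2 (hz.exists_dist_lt p hρ)
  have hlen := (Filter.eventually_all_finset t).2 fun j _ =>
    PseudoOrbit.eventually_of_denseRange hz hη j i
  filter_upwards [(tendsto_sub_atTop_nat 1).eventually hlen, eventually_ge_atTop 1] with k hk hk₁
  have hpiece (j : ℕ) (hj : j ∈ t) : Reaches κ Leb k (f ⁻¹' Metric.ball (z j) ρ) (W i) := by
    simpa only [Nat.add_sub_cancel' hk₁] using (hcover j).trans_pseudoOrbit hW hstep (hk j hj)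
  refine (Reaches.biUnion hpiece).mono_left (.of_forall fun x _ => ?_)
  simpa using ht (mem_univ (f x))

theorem exists_reaches_univ_of_dense_orbit [CompactSpace M] [ConnectedSpace M]
    [Leb.IsOpenPosMeasure] {Y : Set M} (hY : ∀ᵐ x ∂Leb, x ∈ Y) (hfY : ContinuousOn f Y)
    {x₀ : M} (hx₀ : Dense (range fun n : ℕ => f^[n] x₀)) (hx₀Y : ∀ n : ℕ, f^[n] x₀ ∈ Y)
    (hρ : 0 < ρ) {c : ℝ≥0∞} (hc : c ≠ 0)
    (hκ : ∀ᵐ x ∂Leb, c • Leb.restrict (Metric.ball (f x) ρ) ≤ κ x)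
    (hU : IsOpen U) (hU' : U.Nonempty) :
    ∃ k V, Reaches κ Leb k univ V ∧ Leb (U ∩ V) ≠ 0 := by
  set z : ℕ → M := fun n => f^[n] x₀
  have hnhd (i : ℕ) :
      ∃ u, IsOpen u ∧ z i ∈ u ∧ ∀ x ∈ u, x ∈ Y → dist (f x) (z (i + 1)) < ρ / 2 := by
    obtain ⟨u, hu, hi, hsub⟩ := mem_nhdsWithin.1
      (hfY (z i) (hx₀Y i) (Metric.ball_mem_nhds (f (z i)) (half_pos hρ)))
    refine ⟨u, hu, hi, fun x hxu hxY => ?_⟩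
    rw [show z (i + 1) = f (z i) from Function.iterate_succ_apply' f i x₀]
    exact hsub ⟨hxu, hxY⟩
  choose u hu_open hzu hu using hnhd
  let W (i : ℕ) : Set M := u i ∩ Metric.ball (z i) (ρ / 4)
  have hW_open (i : ℕ) : IsOpen (W i) := (hu_open i).inter Metric.isOpen_ball
  have hzW (i : ℕ) : z i ∈ W i := ⟨hzu i, Metric.mem_ball_self (by positivity)⟩
  have hW (i : ℕ) : Leb (W i) ≠ 0 := ((hW_open i).measure_pos Leb ⟨z i, hzW i⟩).ne'
  have hcover (j : ℕ) : Reaches κ Leb 1 (f ⁻¹' Metric.ball (z j) (3 * ρ / 4)) (W j) := by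
    refine reaches_one_of_subset_ball hc hκ fun x hx y hy => ?_
    have hfx : dist (f x) (z j) < 3 * ρ / 4 := hx
    have hyz : dist y (z j) < ρ / 4 := hy.2
    exact (dist_triangle_right y (f x) (z j)).trans_lt (by linarith)
  have hstep (i j : ℕ) (hij : dist (z (i + 1)) (z j) < ρ / 4) : Reaches κ Leb 1 (W i) (W j) := by
    refine (hcover j).mono_left ?_
    filter_upwards [hY] with x hxY hx
    exact (dist_triangle _ (z (i + 1)) _).trans_lt (by linarith [hu i x hx.1 hxY])
  obtain ⟨_, ⟨i, rfl⟩, hiU⟩ := hx₀.exists_mem_open hU hU'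
  obtain ⟨k, hk⟩ := (eventually_reaches_univ hx₀ (by positivity : 0 < ρ / 4) hW hstep
    (by positivity) hcover i).exists
  exact ⟨k, W i, hk, ((hU.inter (hW_open i)).measure_pos Leb ⟨z i, hiU, hzW i⟩).ne'⟩

end Reachability

section SmoothVolume

variable {d : ℕ} {M : Type*} [TopologicalSpace M] [MeasurableSpace M]
  [ChartedSpace (EuclideanSpace ℝ (Fin d)) M] {Leb : Measure M}

theorem IsSmoothVolume.isOpenPosMeasure [OpensMeasurableSpace M] (h : IsSmoothVolume d Leb) :
    Leb.IsOpenPosMeasure := by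
  refine ⟨fun U hU ⟨x, hx⟩ hLebU => ?_⟩
  set e := chartAt (EuclideanSpace ℝ (Fin d)) x
  obtain ⟨ρ, hρ, hρ_pos, hLeb⟩ := h e (chart_mem_atlas _ x)
  set V := e '' (U ∩ e.source)
  have hV : IsOpen V := e.isOpen_image_of_subset_source (hU.inter e.open_source) inter_subset_right
  have hVe : V ⊆ e.target := (image_mono inter_subset_right).trans e.image_source_eq_target.subset
  have hint : ∫⁻ y in V, ENNReal.ofReal (ρ y) = 0 := by
    rw [← hLeb _ (hU.inter e.open_source).measurableSet inter_subset_right]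
    exact measure_mono_null inter_subset_left hLebU
  refine ((hV.measure_pos volume ⟨e x, x, ⟨hx, mem_chart_source _ x⟩, rfl⟩).trans_le
    (?_ : volume V ≤ 0)).false
  have hρV : AEMeasurable (fun y => ENNReal.ofReal (ρ y)) (volume.restrict V) :=
    ((hρ.continuousOn.mono hVe).aemeasurable hV.measurableSet).ennreal_ofReal
  have hnull := (ae_restrict_iff' hV.measurableSet).1 ((lintegral_eq_zero_iff' hρV).1 hint)
  refine (measure_mono_null (fun y hy hy₀ => ?_) hnull).le
  exact (ENNReal.ofReal_pos.2 (hρ_pos y (hVe hy))).ne' (hy₀ hy)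

theorem IsSmoothVolume.nullSingletonClass [MeasurableSingletonClass M] (h : IsSmoothVolume d Leb)
    (hd : 0 < d) : NullSingletonClass Leb := by
  have : Nonempty (Fin d) := ⟨⟨0, hd⟩⟩
  refine ⟨fun x => ?_⟩
  obtain ⟨ρ, -, -, hLeb⟩ := h _ (chart_mem_atlas (EuclideanSpace ℝ (Fin d)) x)
  rw [hLeb {x} (measurableSet_singleton x) (singleton_subset_iff.2 (mem_chart_source _ x)),
    image_singleton]
  exact setLIntegral_measure_zero _ _ (measure_singleton _)

end SmoothVolume

theorem tendsto_measure_ball_zero {M : Type*} [MetricSpace M] [MeasurableSpace M]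
    [OpensMeasurableSpace M] {Leb : Measure M} [IsFiniteMeasure Leb] [NullSingletonClass Leb]
    (ζ : M) {δ : ℕ → ℝ} (hδ_pos : ∀ n, 0 < δ n) (hδ : Tendsto δ atTop (𝓝 0)) :
    Tendsto (fun n => Leb (Metric.ball ζ (δ n))) atTop (𝓝 0) := by
  have hball := tendsto_measure_biInter_gt (μ := Leb) (s := Metric.ball ζ) (a := 0)
    (fun _ _ => Metric.isOpen_ball.nullMeasurableSet)
    (fun _ _ _ => Metric.ball_subset_ball) ⟨1, one_pos, measure_ne_top _ _⟩
  rw [Metric.biInter_gt_ball, Metric.closedBall_zero, measure_singleton] at hball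
  exact hball.comp (tendsto_nhdsWithin_iff.2 ⟨hδ, .of_forall hδ_pos⟩)

section LocalDensityBounds

variable {M : Type*} [MeasurableSpace M] {κ : Kernel M M} {Leb μ : Measure M}

theorem IsStationaryMeasure.invariant [IsMarkovKernel κ] [IsProbabilityMeasure μ]
    (h : IsStationaryMeasure (fun x => κ x) μ) : κ.Invariant μ := by
  refine Measure.ext fun A hA => ?_
  have hκA : ∫⁻ x, κ x A ∂μ ≤ 1 :=
    (lintegral_mono fun x => prob_le_one).trans (by simp)
  rw [Measure.bind_apply hA κ.aemeasurable]
  refine (ENNReal.toReal_eq_toReal_iff' (hκA.trans_lt ENNReal.one_lt_top).ne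
    (measure_ne_top _ _)).1 ?_
  calc (∫⁻ x, κ x A ∂μ).toReal
      = ∫ x, (κ x).real A ∂μ := (integral_toReal (κ.measurable_coe hA).aemeasurable
        (.of_forall fun _ => measure_lt_top _ _)).symm
    _ = μ.real A := by
        simpa only [integral_indicator_one hA] using
          h (A.indicator 1) ((integrable_const (1 : ℝ)).indicator hA)

theorem absolutelyContinuous_of_invariant (hμ : κ.Invariant μ) (hac : ∀ᵐ x ∂μ, κ x ≪ Leb) :
    μ ≪ Leb := by
  refine Measure.AbsolutelyContinuous.mk fun A hA hLebA => ?_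
  rw [← hμ.def, Measure.bind_apply hA κ.aemeasurable]
  exact lintegral_eq_zero_of_ae_eq_zero (hac.mono fun x hx => hx hLebA)

theorem smul_restrict_le_withDensity {c : ℝ≥0∞} {g : M → ℝ≥0∞} {s : Set M} (hs : MeasurableSet s)
    (hg : ∀ᵐ y ∂Leb, y ∈ s → c ≤ g y) : c • Leb.restrict s ≤ Leb.withDensity g :=
  calc c • Leb.restrict s = (Leb.restrict s).withDensity fun _ => c := (withDensity_const c).symm
    _ ≤ (Leb.restrict s).withDensity g := withDensity_mono ((ae_restrict_iff' hs).2 hg)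
    _ = (Leb.withDensity g).restrict s := (restrict_withDensity hs g).symm
    _ ≤ Leb.withDensity g := Measure.restrict_le_self

theorem withDensity_le_smul {C : ℝ≥0∞} {g : M → ℝ≥0∞} {s : Set M} (hs : MeasurableSet s)
    (hs' : Leb.withDensity g sᶜ = 0) (hg : ∀ᵐ y ∂Leb, y ∈ s → g y ≤ C) :
    Leb.withDensity g ≤ C • Leb :=
  calc Leb.withDensity g = (Leb.withDensity g).restrict s :=
        (Measure.restrict_eq_self_of_ae_mem (mem_ae_iff.2 hs')).symm
    _ = (Leb.restrict s).withDensity g := restrict_withDensity hs g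
    _ ≤ (Leb.restrict s).withDensity fun _ => C := withDensity_mono ((ae_restrict_iff' hs).2 hg)
    _ = C • Leb.restrict s := withDensity_const C
    _ ≤ C • Leb := by gcongr; exact Measure.restrict_le_self

/-- The transition probabilities `q_x Leb` of `densityKernel`, bundled as a kernel. -/
def densityMarkovKernel [TopologicalSpace M] [BorelSpace M] [SecondCountableTopology M]
    [LocallyCompactSpace M] (Leb : Measure M) [SFinite Leb] {q : M → C(M, ℝ)}
    (hq : Continuous q) : Kernel M M where
  toFun := densityKernel Leb q
  measurable' := by
    have hcont : Continuous fun p : M × M => q p.1 p.2 :=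
      (hq.comp continuous_fst).eval continuous_snd
    refine Measure.measurable_of_measurable_coe _ fun A hA => ?_
    simp only [densityKernel, withDensity_apply _ hA]
    exact hcont.measurable.ennreal_ofReal.lintegral_prod_right'

variable [MetricSpace M] {f : M → M}

/-- From almost every point `x` the transition probability `κ x` has a density with respect to `Leb`
that is bounded above, and bounded away from zero on a ball of fixed radius around `f x`. This is
what both perturbation schemes provide. -/
def HasLocalDensityBounds (κ : Kernel M M) (Leb : Measure M) (f : M → M) : Prop :=
  ∃ (ρ : ℝ) (c C : ℝ≥0∞), 0 < ρ ∧ c ≠ 0 ∧ C ≠ ⊤ ∧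
    ∀ᵐ x ∂Leb, c • Leb.restrict (Metric.ball (f x) ρ) ≤ κ x ∧ κ x ≤ C • Leb

variable [BorelSpace M]

theorem IsUniformRandomPerturbation.hasLocalDensityBounds [SecondCountableTopology M]
    {X : Type*} [MetricSpace X] [MeasurableSpace X] {θ : Measure X} {F : M → X → M}
    (h : IsUniformRandomPerturbation Leb f F θ) (hκ : ∀ x, κ x = transition F θ x) :
    HasLocalDensityBounds κ Leb f := by
  obtain ⟨-, ⟨ρ, hρ, hball⟩, qlo, qhi, hqlo, -, hq⟩ := h
  refine ⟨ρ, qlo, qhi, hρ, by exact_mod_cast hqlo.ne', ENNReal.coe_ne_top, ?_⟩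
  filter_upwards [hball, hq] with x hx ⟨q, _, hqx, hqb⟩
  have hlo : ∀ᵐ y ∂Leb, y ∈ Metric.ball (f x) ρ → (qlo : ℝ≥0∞) ≤ q y := by
    filter_upwards [hqb] with y hy hyx using by exact_mod_cast (hy (hx hyx)).1
  have hhi : ∀ᵐ y ∂Leb, y ∈ (transition F θ x).support → (q y : ℝ≥0∞) ≤ qhi := by
    filter_upwards [hqb] with y hy hyx using by exact_mod_cast (hy hyx).2
  have hsupp : Leb.withDensity (fun y => (q y : ℝ≥0∞)) (transition F θ x).supportᶜ = 0 :=
    hqx ▸ Measure.measure_compl_support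
  rw [hκ, hqx]
  exact ⟨smul_restrict_le_withDensity Metric.isOpen_ball.measurableSet hlo,
    withDensity_le_smul Measure.isClosed_support.measurableSet hsupp hhi⟩

theorem IsRegularMarkovPerturbation.hasLocalDensityBounds {Y : Set M} {q : M → C(M, ℝ)}
    (h : IsRegularMarkovPerturbation Leb f Y q) (hY : ∀ᵐ x ∂Leb, x ∈ Y)
    (hκ : ∀ x, κ x = densityKernel Leb q x) : HasLocalDensityBounds κ Leb f := by
  obtain ⟨qlo, qhi, hqlo, -, hq⟩ := h.bounds
  refine ⟨1, ENNReal.ofReal qlo, ENNReal.ofReal qhi, one_pos, by simpa using hqlo,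
    ENNReal.ofReal_ne_top, ?_⟩
  filter_upwards [hY] with x hx
  rw [hκ]
  exact ⟨smul_restrict_le_withDensity Metric.isOpen_ball.measurableSet
      (.of_forall fun y _ => ENNReal.ofReal_le_ofReal (hq x hx y).1),
    withDensity_le_smul .univ (by simp)
      (.of_forall fun y _ => ENNReal.ofReal_le_ofReal (hq x hx y).2)⟩

end LocalDensityBounds

section DenseOrbit

variable {M : Type*} [MetricSpace M] [CompactSpace M] [ConnectedSpace M] [MeasurableSpace M]
  [BorelSpace M] {Leb μ : Measure M} [IsProbabilityMeasure Leb] [Leb.IsOpenPosMeasure]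
  [IsProbabilityMeasure μ] {f : M → M} {Y : Set M} {x₀ : M} {κ : Kernel M M} [IsMarkovKernel κ]

theorem HasLocalDensityBounds.hasExponentialHTSRTS (hκ : HasLocalDensityBounds κ Leb f)
    (hY : ∀ᵐ x ∂Leb, x ∈ Y) (hfY : ContinuousOn f Y)
    (hx₀ : Dense (range fun n : ℕ => f^[n] x₀)) (hx₀Y : ∀ n : ℕ, f^[n] x₀ ∈ Y)
    (hμ : κ.Invariant μ) (hμac : μ ≪ Leb) {B : ℕ → Set M} (hB_open : ∀ n, IsOpen (B n))
    (hB_ne : ∀ n, (B n).Nonempty) (hB_lim : Tendsto (fun n => Leb (B n)) atTop (𝓝 0))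
    {P : Measure (ℕ → M)} [IsProbabilityMeasure P] (hP : IsMarkovChainLaw (fun x => κ x) μ P) :
    HasExponentialHTSRTS P pathShift fun n => {z | z 0 ∈ B n} := by
  obtain ⟨ρ, c, C, hρ, hc, hC, hbounds⟩ := hκ
  have hlow := hbounds.mono fun x hx => hx.1
  have hupp := hbounds.mono fun x hx => hx.2
  have hac : ∀ᵐ x ∂Leb, κ x ≪ Leb := hupp.mono fun _ => Measure.absolutelyContinuous_of_le_smul
  have hreach {U : Set M} (hU : IsOpen U) (hU_ne : U.Nonempty) :
      ∃ k V, Reaches κ Leb k univ V ∧ Leb (U ∩ V) ≠ 0 :=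
    exists_reaches_univ_of_dense_orbit hY hfY hx₀ hx₀Y hρ hc hlow hU hU_ne
  have hmix (e : ℝ≥0∞) (he : e ≠ 0) : ∃ s, MixesWithin κ Leb μ s e := by
    obtain ⟨k, V, ⟨b, hb, hV⟩, hV₀⟩ := hreach isOpen_univ univ_nonempty
    rw [univ_inter] at hV₀
    have hν₀ : b • Leb.restrict V ≠ 0 := fun h => by
      simpa [hb, hV₀] using congr($h univ)
    have hν := hV.mono fun x hx => hx (mem_univ x)
    exact exists_mixesWithin_of_minorization hac hν₀ hν hμ hμac he
  have hB_pos (n : ℕ) : μ (B n) ≠ 0 := fun hn => by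
    obtain ⟨k, V, hV, hV₀⟩ := hreach (hB_open n) (hB_ne n)
    obtain ⟨b, hb, hbμ⟩ := hV.exists_smul_restrict_le hμ hμac
    have hBV : b * Leb (B n ∩ V) ≤ 0 := by
      simpa [Measure.restrict_apply (hB_open n).measurableSet, hn] using hbμ (B n)
    exact mul_ne_zero hb hV₀ (le_zero_iff.1 hBV)
  exact hP.hasExponentialHTSRTS hmix hμ hμac hC hupp (fun n => (hB_open n).measurableSet) hB_pos
    hB_lim

end DenseOrbit

end

theorem corollaryD_general
    {M : Type u} [MetricSpace M] [CompactSpace M] [ConnectedSpace M]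
    [MeasurableSpace M] [BorelSpace M]
    (Leb : Measure M) [IsProbabilityMeasure Leb] [Leb.IsOpenPosMeasure] [NullSingletonClass Leb]
    (f : M → M)
    (Y : Set M) (hY : ∀ᵐ x ∂Leb, x ∈ Y) (hfY : ContinuousOn f Y)
    (x₀ : M) (hx₀_dense : Dense (Set.range fun n : ℕ => f^[n] x₀))
    (hx₀_mem : ∀ n : ℕ, f^[n] x₀ ∈ Y)
    (μ : Measure M) [IsProbabilityMeasure μ]
    (ζ : M) (δ : ℕ → ℝ) (hδ_pos : ∀ n, 0 < δ n) (hδ : Tendsto δ atTop (𝓝 0)) :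
    (∀ (X : Type v) [MetricSpace X] [MeasurableSpace X]
        (θ : Measure X) [IsProbabilityMeasure θ] (F : M → X → M),
      Measurable (Function.uncurry F) →
      IsUniformRandomPerturbation Leb f F θ →
      IsStationaryMeasure (transition F θ) μ →
      (∀ᵐ x ∂μ, transition F θ x ≪ Leb) →
      HasExponentialHTSRTS (annealed μ θ) (skewProduct F)
        (fun n => Metric.ball ζ (δ n) ×ˢ (Set.univ : Set (ℕ → X)))) ∧
    (∀ q : M → C(M, ℝ),
      IsRegularMarkovPerturbation Leb f Y q →
      IsStationaryMeasure (densityKernel Leb q) μ →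
      (∀ (X : Type w) [MeasurableSpace X] (θ : Measure X) [IsProbabilityMeasure θ]
          (F : M → X → M),
        Measurable (Function.uncurry F) →
        (∀ x, transition F θ x = densityKernel Leb q x) →
        HasExponentialHTSRTS (annealed μ θ) (skewProduct F)
          (fun n => Metric.ball ζ (δ n) ×ˢ (Set.univ : Set (ℕ → X)))) ∧
      (∀ (P : Measure (ℕ → M)) [IsProbabilityMeasure P],
        IsMarkovChainLaw (densityKernel Leb q) μ P →
        HasExponentialHTSRTS P pathShift
          (fun n => {z | z 0 ∈ Metric.ball ζ (δ n)}))) := by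
  have : SecondCountableTopology M := UniformSpace.secondCountable_of_separable M
  have hchain {κ : Kernel M M} [IsMarkovKernel κ] (hκ : HasLocalDensityBounds κ Leb f)
      (hstat : IsStationaryMeasure (fun x => κ x) μ) (hac : ∀ᵐ x ∂μ, κ x ≪ Leb)
      {P : Measure (ℕ → M)} [IsProbabilityMeasure P] (hP : IsMarkovChainLaw (fun x => κ x) μ P) :
      HasExponentialHTSRTS P pathShift fun n => {z | z 0 ∈ Metric.ball ζ (δ n)} :=
    hκ.hasExponentialHTSRTS hY hfY hx₀_dense hx₀_mem hstat.invariant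
      (absolutelyContinuous_of_invariant hstat.invariant hac) (fun _ => Metric.isOpen_ball)
      (fun n => ⟨ζ, Metric.mem_ball_self (hδ_pos n)⟩) (tendsto_measure_ball_zero ζ hδ_pos hδ) hP
  refine ⟨fun X _ _ θ _ F hF hpert hstat hac => ?_, fun q hq hstat => ?_⟩
  · have := isMarkovKernel_transitionKernel (θ := θ) hF
    exact hasExponentialHTSRTS_skewProduct hF fun P _ hP => hchain (κ := transitionKernel hF θ)
      (hpert.hasLocalDensityBounds fun _ => rfl) hstat hac hP
  · have : IsMarkovKernel (densityMarkovKernel Leb hq.continuous) := ⟨hq.isProbability⟩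
    have hpath (P : Measure (ℕ → M)) [IsProbabilityMeasure P] :
        IsMarkovChainLaw (densityKernel Leb q) μ P →
          HasExponentialHTSRTS P pathShift fun n => {z | z 0 ∈ Metric.ball ζ (δ n)} :=
      hchain (κ := densityMarkovKernel Leb hq.continuous)
        (hq.hasLocalDensityBounds hY fun _ => rfl) hstat
        (.of_forall fun _ => withDensity_absolutelyContinuous _ _)
    refine ⟨fun X _ θ _ F hF hFq => hasExponentialHTSRTS_skewProduct hF fun P _ hP => ?_, hpath⟩
    exact hpath P (funext hFq ▸ hP)

theorem corollaryD
    (d : ℕ) (hd : 0 < d)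
    {M : Type u} [MetricSpace M] [CompactSpace M] [ConnectedSpace M]
    [MeasurableSpace M] [BorelSpace M]
    [ChartedSpace (EuclideanSpace ℝ (Fin d)) M] [IsManifold (𝓡 d) ∞ M]
    [RiemannianBundle (fun x : M => TangentSpace (𝓡 d) x)]
    [IsContMDiffRiemannianBundle (𝓡 d) ∞ (EuclideanSpace ℝ (Fin d))
      (fun x : M => TangentSpace (𝓡 d) x)]
    [IsRiemannianManifold (𝓡 d) M]
    (Leb : Measure M) [IsProbabilityMeasure Leb] (hLeb : IsSmoothVolume d Leb)
    (f : M → M) (hf : Measurable f)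
    (Y : Set M) (hY : ∀ᵐ x ∂Leb, x ∈ Y) (hfY : ContinuousOn f Y)
    (x₀ : M) (hx₀_dense : Dense (Set.range fun n : ℕ => f^[n] x₀))
    (hx₀_mem : ∀ n : ℕ, f^[n] x₀ ∈ Y)
    (μ : Measure M) [IsProbabilityMeasure μ]
    (ζ : M) (δ : ℕ → ℝ) (hδ_pos : ∀ n, 0 < δ n) (hδ : Tendsto δ atTop (𝓝 0)) :
    -- random maps scheme
    (∀ (X : Type v) [MetricSpace X] [CompactSpace X] [MeasurableSpace X] [BorelSpace X]
        (θ : Measure X) [IsProbabilityMeasure θ] (F : M → X → M),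
      Measurable (Function.uncurry F) →
      IsUniformRandomPerturbation Leb f F θ →
      IsStationaryMeasure (transition F θ) μ →
      (∀ᵐ x ∂μ, transition F θ x ≪ Leb) →
      HasExponentialHTSRTS (annealed μ θ) (skewProduct F)
        (fun n => Metric.ball ζ (δ n) ×ˢ (Set.univ : Set (ℕ → X)))) ∧
    -- Markov chain, in any representation by random maps and on its path space
    (∀ q : M → C(M, ℝ),
      IsRegularMarkovPerturbation Leb f Y q →
      IsStationaryMeasure (densityKernel Leb q) μ →
      (∀ (X : Type w) [MeasurableSpace X] (θ : Measure X) [IsProbabilityMeasure θ]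
          (F : M → X → M),
        Measurable (Function.uncurry F) →
        (∀ x, transition F θ x = densityKernel Leb q x) →
        HasExponentialHTSRTS (annealed μ θ) (skewProduct F)
          (fun n => Metric.ball ζ (δ n) ×ˢ (Set.univ : Set (ℕ → X)))) ∧
      (∀ (P : Measure (ℕ → M)) [IsProbabilityMeasure P],
        IsMarkovChainLaw (densityKernel Leb q) μ P →
        HasExponentialHTSRTS P pathShift
          (fun n => {z | z 0 ∈ Metric.ball ζ (δ n)}))) := by
  have := hLeb.isOpenPosMeasure
  have := hLeb.nullSingletonClass hd
  obtain ⟨hmaps, hchains⟩ := corollaryD_general Leb f Y hY hfY x₀ hx₀_dense hx₀_mem μ ζ δ hδ_pos hδ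
  exact ⟨fun X _ _ _ _ => hmaps X, hchains⟩
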